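/- Let $S=\mathbb R\times\mathbb R\times(0,\infty)$ with points $(\xi,s,\lambda)$, and call a Borel set $E\subseteq S$ bounded if it has finite Lebesgue measure. A Lévy basis $L$ on $S$ is a family of real random variables $L(E)$, $E$ bounded, such that values on disjoint sets are independent, $L(\bigcup_j E_j)=\sum_j L(E_j)$ almost surely for disjoint bounded $E_j$ with bounded union, and all finite vectors $(L(B_1),\dots,L(B_k))$ are infinitely divisible. Let $\alpha_0>2$, $\beta_0>0$, $c_0>0$, and let $f(\lambda)=\frac{\beta_0^{\alpha_0}}{\Gamma(\alpha_0)}\lambda^{\alpha_0-1}e^{-\beta_0\lambda}$ be the Gamma density with shape $\alpha_0$ and rate $\beta_0$. Put $\kappa(d\xi,ds,d\lambda)=d\xi\,ds\,f(\lambda)\,d\lambda$. Let $L$ be a Lévy basis on $S$ with finite second moments and characteristic quadruplet $(a,b,\nu,\kappa)$, where $a\in\mathbb R$, $b\ge 0$ and $\nu$ is a Lévy measure; that is, $\mathbb E[e^{i\theta L(E)}]=e^{\kappa(E)\psi(\theta)}$ for all bounded $E$ and $\theta\in\mathbb R$, with $$\psi(\theta)=i\theta a-\tfrac12\theta^2 b+\int_{\mathbb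 R}\bigl(e^{i\theta z}-1-i\theta z\mathbf 1_{|z|\le 1}\bigr)\,\nu(dz).$$ Let $L'$ be the Lévy seed, i.e. a random variable with $\mathbb E[e^{i\theta L'}]=e^{\psi(\theta)}$, and suppose that $\operatorname{Var}(L')>0$. For $x,t\in\mathbb R$ let $$Y_t(x)=\int_0^\infty\int_{A_t(x)}e^{-\lambda(t-s)}\,L(d\xi,ds,d\lambda),\qquad A_t(x)=\{(\xi,s): s\le t,\ |x-\xi|\le c_0|t-s|\}.$$ Here a measurable $g:S\to\mathbb R$ is $L$-integrable if there are simple functions $g_n=\sum_j y_j\mathbf 1_{E_j}$ ($E_j$ bounded and disjoint) with $g_n\to g$ $\kappa$-almost everywhere such that $\int_A g_n\,dL:=\sum_j y_jL(A\cap E_j)$ converges in probability for every Borel set $A\subseteq S$, and $\int_A g\,dL$ is that limit; $Y_t(x)$ is the integral over $S$ of $e^{-\lambda(t-s)}\mathbf 1_{A_t(x)}(\xi,s)$. Fix an integer $m\ge 2$ and a grid size $\triangle>0$. For a parameter vector $\boldsymbol\beta=(\alpha,\beta,c,\mu,\sigma^2)\in\Theta=(2,\infty)\times(0,\infty)\times(0,\infty)\times\mathbb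 R\times[0,\infty)$ put $M(\boldsymbol\beta)=\frac{2c\beta^2\mu}{(\alpha-2)(\alpha-1)}$, and let $f_Y(\boldsymbol\beta;x,t)\in\mathbb R^{2(1+m)}$ be the random vector with components $$Y_t(x)-M(\boldsymbol\beta),\qquad Y_t(x)^2-\frac{c\beta^2\sigma^2}{2(\alpha-2)(\alpha-1)}-M(\boldsymbol\beta)^2,$$ $$Y_t(x)Y_t(x+h\triangle)-\frac{c\beta^\alpha\sigma^2}{2(\beta+h\triangle/c)^{\alpha-2}(\alpha-2)(\alpha-1)}-M(\boldsymbol\beta)^2\qquad(h=1,\dots,m),$$ $$Y_t(x)Y_{t+h\triangle}(x)-\frac{c\beta^\alpha\sigma^2}{2(\beta+h\triangle)^{\alpha-2}(\alpha-2)(\alpha-1)}-M(\boldsymbol\beta)^2\qquad(h=1,\dots,m).$$ Then for every $\boldsymbol\beta\in\Theta$ all components of $f_Y(\boldsymbol\beta;x,t)$ are integrable, for all $x,t\in\mathbb R$. Moreover, the true parameter vector $\boldsymbol\beta_0=(\alpha_0,\beta_0,c_0,\mathbb E[L'],\operatorname{Var}(L'))$ is identifiable: for every nonempty set $G\subseteq\mathbb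 R^2$ of space-time locations (for instance the sampling grid, or all of $\mathbb R^2$) and every $\boldsymbol\beta\in\Theta$, $$\mathbb E\bigl[f_Y(\boldsymbol\beta;x,t)\bigr]=\mathbf 0\ \text{ for all }(x,t)\in G\quad\Longleftrightarrow\quad\boldsymbol\beta=\boldsymbol\beta_0 .$$ -/

import Mathlib

open MeasureTheory ProbabilityTheory Filter Topology

noncomputable section

namespace MSTOU

/-! ### Lévy bases, characteristic quadruplets and Lévy seeds -/

section LevyBasis

variable {S Ω : Type*} [MeasureSpace S] [MeasurableSpace Ω]

/-- The Lebesgue-bounded Borel sets: measurable sets of finite Lebesgue measure. -/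
def IsBddSet (E : Set S) : Prop :=
  MeasurableSet E ∧ volume E < ⊤

/-- The `n`-fold convolution of a law on `ℝ^m` with itself. -/
def convIter {m : ℕ} (μ : Measure (Fin m → ℝ)) : ℕ → Measure (Fin m → ℝ)
  | 0 => Measure.dirac 0
  | n + 1 => Measure.conv (convIter μ n) μ

/-- Infinite divisibility of a law on `ℝ^m`. -/
def IsInfDivisible {m : ℕ} (μ : Measure (Fin m → ℝ)) : Prop :=
  ∀ n : ℕ, 1 ≤ n → ∃ ρ : Measure (Fin m → ℝ), IsProbabilityMeasure ρ ∧ μ = convIter ρ n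

/-- A Lévy basis: an independently scattered, infinitely divisible random measure, indexed by the
Lebesgue-bounded sets (the values of `L` on other sets are irrelevant). The series in `additive`
is an ordered, not necessarily absolutely convergent, series. -/
structure IsLevyBasis (P : Measure Ω) (L : Set S → Ω → ℝ) : Prop where
  measurable : ∀ E, IsBddSet E → Measurable (L E)
  additive : ∀ E : ℕ → Set S, (∀ i, IsBddSet (E i)) → Pairwise (fun i j => Disjoint (E i) (E j)) →
    IsBddSet (⋃ i, E i) →
    ∀ᵐ ω ∂P, Tendsto (fun n => ∑ i ∈ Finset.range n, L (E i) ω) atTop (𝓝 (L (⋃ i, E i) ω))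
  indep : ∀ E F : Set S, IsBddSet E → IsBddSet F → Disjoint E F → IndepFun (L E) (L F) P
  infDivisible : ∀ (m : ℕ) (B : Fin m → Set S), (∀ j, IsBddSet (B j)) →
    IsInfDivisible (P.map (fun ω j => L (B j) ω))

/-- A Lévy measure on the real line. -/
structure IsLevyMeasure (ν : Measure ℝ) : Prop where
  zero : ν {0} = 0
  lintegral_lt_top : ∫⁻ z, ENNReal.ofReal (min 1 (z ^ 2)) ∂ν < ⊤

/-- The Lévy–Khintchine exponent
`i θ a - θ² b / 2 + ∫ (exp (i θ z) - 1 - i θ z 1_{|z| ≤ 1}) ν(dz)`. -/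
def levyExponent (a b : ℝ) (ν : Measure ℝ) (θ : ℝ) : ℂ :=
  Complex.I * θ * a - (θ : ℂ) ^ 2 * b / 2 +
    ∫ z : ℝ, (Complex.exp (Complex.I * θ * z) - 1 -
      (if |z| ≤ 1 then Complex.I * θ * z else 0)) ∂ν

/-- `L` has characteristic quadruplet `(a, b, ν, κ)`, with `a`, `b`, `ν` not depending on the point
of `S`: the cumulant function of `L(E)` is `κ(E)` times the Lévy–Khintchine exponent. -/
structure HasCharQuadruplet (P : Measure Ω) (L : Set S → Ω → ℝ) (a b : ℝ) (ν : Measure ℝ)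
    (κ : Measure S) : Prop where
  b_nonneg : 0 ≤ b
  levyMeasure : IsLevyMeasure ν
  finite : ∀ E, IsBddSet E → κ E < ⊤
  charFun_eq : ∀ E, IsBddSet E → ∀ θ : ℝ,
    charFun (P.map (L E)) θ = Complex.exp ((κ E).toReal * levyExponent a b ν θ)

/-- `L'` is a Lévy seed with triplet `(a, b, ν)`. -/
structure IsLevySeed (P : Measure Ω) (L' : Ω → ℝ) (a b : ℝ) (ν : Measure ℝ) : Prop where
  measurable : Measurable L'
  charFun_eq : ∀ θ : ℝ, charFun (P.map L') θ = Complex.exp (levyExponent a b ν θ)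

/-- The Lévy basis has finite second moments. -/
def HasFiniteSecondMoments (P : Measure Ω) (L : Set S → Ω → ℝ) : Prop :=
  ∀ E, IsBddSet E → MemLp (L E) 2 P

/-! ### Stochastic integrals -/

variable (S) in
/-- A simple function `∑ j, y j • 1_{E j}` on `S`, with disjoint Lebesgue-bounded `E j`. -/
structure SimpleIntegrand where
  card : ℕ
  set : Fin card → Set S
  coeff : Fin card → ℝ
  bdd : ∀ j, IsBddSet (set j)
  disjoint : Pairwise (fun i j => Disjoint (set i) (set j))

/-- The function on `S` represented by a simple integrand. -/
def SimpleIntegrand.toFun (h : SimpleIntegrand S) (z : S) : ℝ :=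
  ∑ j, (h.set j).indicator (fun _ => h.coeff j) z

/-- The stochastic integral `∫_A h dL = ∑ j, y j L(A ∩ E j)` of a simple function. -/
def SimpleIntegrand.integral (h : SimpleIntegrand S) (L : Set S → Ω → ℝ) (A : Set S) (ω : Ω) : ℝ :=
  ∑ j, h.coeff j * L (A ∩ h.set j) ω

/-- The simple functions `h n` witness that `g` is `L`-integrable: `h n → g` almost everywhere
with respect to `κ`, and `∫_A h n dL` converges in probability for every Borel set `A`. -/
structure IsApproximating (P : Measure Ω) (L : Set S → Ω → ℝ) (κ : Measure S) (g : S → ℝ)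
    (h : ℕ → SimpleIntegrand S) : Prop where
  ae_tendsto : ∀ᵐ z ∂κ, Tendsto (fun n => (h n).toFun z) atTop (𝓝 (g z))
  tendstoInMeasure : ∀ A : Set S, MeasurableSet A →
    ∃ Z : Ω → ℝ, TendstoInMeasure P (fun n => (h n).integral L A) atTop Z

/-- `g` is `L`-integrable and the random variable `Z` is (a version of) the stochastic integral
`∫_A g dL`, i.e. the limit in probability of `∫_A h n dL`. -/
def IsStochIntegral (P : Measure Ω) (L : Set S → Ω → ℝ) (κ : Measure S) (g : S → ℝ) (A : Set S)
    (Z : Ω → ℝ) : Prop :=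
  Measurable g ∧ ∃ h : ℕ → SimpleIntegrand S, IsApproximating P L κ g h ∧
    TendstoInMeasure P (fun n => (h n).integral L A) atTop Z

end LevyBasis

/-! ### MSTOU processes in one spatial dimension -/

section Field

variable {Ω : Type*} [MeasurableSpace Ω]

/-- Points `(ξ, s, r)`: spatial location `ξ`, time `s` and rate `r > 0`. -/
abbrev Domain : Type := ℝ × ℝ × Set.Ioi (0 : ℝ)

-- Lebesgue measure on `(0, ∞)`, hence the product Lebesgue measure on `Domain`.
attribute [instance] Measure.Subtype.measureSpace

/-- The measure `dξ ds f(r) dr`. -/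
def controlMeasure (f : ℝ → ENNReal) : Measure Domain :=
  (volume : Measure Domain).withDensity (fun z => f z.2.2)

/-- The ambit set `A_t(x) = {(ξ, s) : s ≤ t, |x - ξ| ≤ g(|t - s|)}`. -/
def ambitSet (g : ℝ → ℝ) (x t : ℝ) : Set (ℝ × ℝ) :=
  {p | p.2 ≤ t ∧ |x - p.1| ≤ g |t - p.2|}

open Classical in
/-- The integrand `(ξ, s, r) ↦ exp (-r (t - s))` on `(ξ, s) ∈ A`, extended by zero. -/
def kernel (A : Set (ℝ × ℝ)) (t : ℝ) (z : Domain) : ℝ :=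
  if (z.1, z.2.1) ∈ A then Real.exp (-(z.2.2 : ℝ) * (t - z.2.1)) else 0

/-- `Y x t` is, at every location `x` and time `t`, the stochastic integral
`∫_0^∞ ∫_{A_t(x)} exp (-r (t - s)) L(dξ, ds, dr)`, with ambit sets `A x t` and with respect to a
Lévy basis with control measure `κ`. -/
def IsMSTOU (P : Measure Ω) (L : Set Domain → Ω → ℝ) (κ : Measure Domain)
    (A : ℝ → ℝ → Set (ℝ × ℝ)) (Y : ℝ → ℝ → Ω → ℝ) : Prop :=
  ∀ x t : ℝ, IsStochIntegral P L κ (kernel (A x t) t) Set.univ (Y x t)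

end Field

/-! ### The moment function -/

/-- A parameter vector `(α, β, c, E[L'], Var(L'))`. -/
@[ext]
structure Params where
  α : ℝ
  β : ℝ
  c : ℝ
  mean : ℝ
  var : ℝ

/-- The parameter space. -/
def paramSpace : Set Params :=
  {θ | 2 < θ.α ∧ 0 < θ.β ∧ 0 < θ.c ∧ 0 ≤ θ.var}

/-- The values entering the moment function: `Y_t(x)` and, for `h = 1, …, m`, the values
`Y_t(x + hΔ)` and `Y_{t + hΔ}(x)`; the entry for lag `h` has index `h - 1`. -/
structure Obs (m : ℕ) where
  here : ℝ
  space : Fin m → ℝ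
  time : Fin m → ℝ

/-- The observation vector of the field `Y` at `(x, t)` with grid size `Δ`. -/
def obs {Ω : Type*} (Y : ℝ → ℝ → Ω → ℝ) (m : ℕ) (Δ x t : ℝ) (ω : Ω) : Obs m where
  here := Y x t ω
  space := fun h => Y (x + ((h : ℝ) + 1) * Δ) t ω
  time := fun h => Y x (t + ((h : ℝ) + 1) * Δ) ω

/-- The `2 (1 + m)` components of the moment function. -/
inductive MomentIndex (m : ℕ) where
  | mean : MomentIndex m
  | variance : MomentIndex m
  | space (h : Fin m) : MomentIndex m
  | time (h : Fin m) : MomentIndex m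

/-- The mean of the process in the model with parameter `θ`. -/
def modelMean (θ : Params) : ℝ :=
  2 * θ.c * θ.β ^ 2 * θ.mean / ((θ.α - 2) * (θ.α - 1))

/-- The moment function `f_Y`. -/
def momentFn {m : ℕ} (Δ : ℝ) (y : Obs m) (θ : Params) : MomentIndex m → ℝ
  | .mean => y.here - modelMean θ
  | .variance =>
      y.here ^ 2 - θ.c * θ.β ^ 2 * θ.var / (2 * (θ.α - 2) * (θ.α - 1)) - modelMean θ ^ 2
  | .space h =>
      y.here * y.space h
        - θ.c * θ.β ^ θ.α * θ.var /
          (2 * (θ.β + ((h : ℝ) + 1) * Δ / θ.c) ^ (θ.α - 2) * (θ.α - 2) * (θ.α - 1))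
        - modelMean θ ^ 2
  | .time h =>
      y.here * y.time h
        - θ.c * θ.β ^ θ.α * θ.var /
          (2 * (θ.β + ((h : ℝ) + 1) * Δ) ^ (θ.α - 2) * (θ.α - 2) * (θ.α - 1))
        - modelMean θ ^ 2

end MSTOU

end

noncomputable section

namespace MSTOU

/-! ### Moments from the characteristic function -/

/-! Write μ and v for the mean and variance of the seed. The core of the proof is that stochastic
integrals satisfy E∫g dL = μ∫g dκ and E[∫g dL ∫g' dL] = v∫gg' dκ + μ²∫g dκ∫g' dκ whenever g and g'
are integrable and square-integrable. The expected moment function is then explicit, and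
identifiability is a question about real powers.

For a single set, the characteristic function of L(E) is the κ(E)-th power of that of the seed, and
two derivatives at 0 give its moments (`moments_of_charFun_eq_exp_mul`). Independence on disjoint
sets then gives the mixed moments (`IsLevyBasis.isSecondOrder`), and bilinearity extends them to
step functions (`StepComb.mul_integral`).

The passage to Y is the delicate point: Y is only a limit in probability along some approximating
sequence, which need be neither dominated nor convergent in L². The limit does not depend on the
sequence (`StepComb.tendsto_probNorm_of_ae_tendsto_zero`, a Baire category argument that uses
convergence over every Borel set). Hence Y is also the L²-limit along a dominated sequence
(`IsStochIntegral.exists_tendsto_toLp`), and the moments pass to the limit.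

The kernel and its products are exponentials over cones, all covered by `integral_cone`. The
autocovariance is the variance times (1 + x/β)^(-(α-2)), with x the temporal lag or the spatial lag
divided by c. The variance is positive at the true parameter and can be divided out. Temporal lags Δ
and 2Δ then determine α and β by strict convexity (`eq_and_eq_of_rpow_eq`), spatial lag Δ determines
c, and the mean and variance of Y give the other two parameters. -/

lemma levyExponent_zero (a b : ℝ) (ν : Measure ℝ) : levyExponent a b ν 0 = 0 := by
  simp [levyExponent]

/-- Small jumps: second-order Taylor bound. Large jumps: both exponentials have modulus one. The
bound is uniform in θ near 0, as dominated convergence requires. -/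
lemma norm_levyIntegrand_le {θ : ℝ} (hθ : |θ| ≤ 1) (z : ℝ) :
    ‖Complex.exp (Complex.I * θ * z) - 1 - (if |z| ≤ 1 then Complex.I * θ * z else 0)‖
      ≤ 2 * min 1 (z ^ 2) := by
  split_ifs with hz
  · have hn : ‖Complex.I * θ * z‖ = |θ| * |z| := by simp
    have h1 : |θ| * |z| ≤ |z| := mul_le_of_le_one_left (abs_nonneg z) hθ
    refine (Complex.norm_exp_sub_one_sub_id_le (hn.trans_le (h1.trans hz))).trans ?_
    rw [hn, min_eq_right (by rw [← sq_abs]; exact pow_le_one₀ (abs_nonneg z) hz), ← sq_abs z]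
    nlinarith [pow_le_pow_left₀ (by positivity) h1 2, sq_nonneg |z|]
  · have hz' : 1 ≤ z ^ 2 := by
      rw [← sq_abs]; exact one_le_pow₀ (not_le.1 hz).le
    rw [min_eq_left hz', sub_zero]
    refine (norm_sub_le _ _).trans ?_
    have : Complex.I * θ * z = ((θ * z : ℝ) : ℂ) * Complex.I := by push_cast; ring
    rw [this, Complex.norm_exp_ofReal_mul_I]
    norm_num

/-- Continuity at 0 is all that is needed of the exponent: it selects the branch of the logarithm.
Smoothness will come from the characteristic functions, so no moments of ν enter. -/
lemma continuousAt_levyExponent (a b : ℝ) {ν : Measure ℝ} (hν : IsLevyMeasure ν) :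
    ContinuousAt (levyExponent a b ν) 0 := by
  unfold levyExponent
  refine ContinuousAt.add (by fun_prop) ?_
  refine continuousAt_of_dominated (bound := fun z => 2 * min 1 (z ^ 2)) ?_ ?_ ?_ ?_
  · refine Eventually.of_forall fun θ => Measurable.aestronglyMeasurable ?_
    refine Measurable.sub (by fun_prop) ?_
    exact Measurable.ite (measurableSet_le (by fun_prop) (by fun_prop)) (by fun_prop) (by fun_prop)
  · have : ∀ᶠ θ : ℝ in 𝓝 0, |θ| ≤ 1 :=
      (continuous_abs.tendsto' 0 0 abs_zero).eventually (Iic_mem_nhds zero_lt_one)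
    filter_upwards [this] with θ hθ
    exact Eventually.of_forall fun z => norm_levyIntegrand_le hθ z
  · refine Integrable.const_mul ⟨Measurable.aestronglyMeasurable (by fun_prop), ?_⟩ 2
    refine lt_of_eq_of_lt (lintegral_congr fun z => ?_) hν.lintegral_lt_top
    exact Real.enorm_of_nonneg (by positivity)
  · refine Eventually.of_forall fun z => ?_
    refine ContinuousAt.sub (by fun_prop) ?_
    split_ifs <;> fun_prop

/-- Derivatives at `0` of a power `exp (k ψ)` of `exp ψ`. -/
lemma deriv_exp_mul_cumulant {φ χ ψ : ℝ → ℂ} {k : ℂ} (hφ : ContDiff ℝ 2 φ) (hχ : ContDiff ℝ 2 χ)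
    (hψ : ContinuousAt ψ 0) (hψ0 : ψ 0 = 0) (hφψ : ∀ θ, φ θ = Complex.exp (ψ θ))
    (hχψ : ∀ θ, χ θ = Complex.exp (k * ψ θ)) :
    deriv χ 0 = k * deriv φ 0 ∧
      deriv (deriv χ) 0 = k * deriv (deriv φ) 0 + (k ^ 2 - k) * deriv φ 0 ^ 2 := by
  have hφ0 : φ 0 = 1 := by simp [hφψ, hψ0]
  have hχ0 : χ 0 = 1 := by simp [hχψ, hψ0]
  -- Near 0 the imaginary part of ψ stays below 1 < π, so the principal logarithm recovers ψ from φ.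
  have hlog : ∀ᶠ θ in 𝓝 (0 : ℝ), ψ θ = Complex.log (φ θ) := by
    have h1 : ∀ᶠ θ in 𝓝 (0 : ℝ), ψ θ ∈ Metric.ball (0 : ℂ) 1 :=
      hψ.eventually (by rw [hψ0]; exact Metric.ball_mem_nhds _ one_pos)
    filter_upwards [h1] with θ hθ
    rw [mem_ball_zero_iff] at hθ
    have him : |(ψ θ).im| < 1 := (Complex.abs_im_le_norm _).trans_lt hθ
    have := abs_lt.1 him
    rw [hφψ, Complex.log_exp] <;> linarith [Real.pi_gt_three]
  have hslit : ∀ᶠ θ in 𝓝 (0 : ℝ), φ θ ∈ Complex.slitPlane :=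
    hφ.continuous.continuousAt.eventually
      (Complex.isOpen_slitPlane.mem_nhds (by rw [hφ0]; exact Complex.one_mem_slitPlane))
  have hφd : Differentiable ℝ φ := hφ.differentiable (by norm_num)
  have hχd : Differentiable ℝ χ := hχ.differentiable (by norm_num)
  have hφ' : Differentiable ℝ (deriv φ) := by
    simpa using hφ.differentiable_iteratedDeriv 1 (by norm_num)
  have hχ' : Differentiable ℝ (deriv χ) := by
    simpa using hχ.differentiable_iteratedDeriv 1 (by norm_num)
  -- This identity no longer mentions ψ; its value at 0 gives the first derivative of χ, and
  -- differentiating it once gives the second.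
  have hode : (fun θ => deriv χ θ * φ θ) =ᶠ[𝓝 0] fun θ => k * (deriv φ θ * χ θ) := by
    filter_upwards [hlog.eventually_nhds, hslit] with θ h1 h2
    have h3 : HasDerivAt ψ (deriv φ θ / φ θ) θ :=
      ((hφd θ).hasDerivAt.clog_real h2).congr_of_eventuallyEq h1
    have h4 : HasDerivAt χ (Complex.exp (k * ψ θ) * (k * (deriv φ θ / φ θ))) θ :=
      ((h3.const_mul k).cexp).congr_of_eventuallyEq (Eventually.of_forall hχψ)
    rw [h4.deriv, ← hχψ]
    have : φ θ ≠ 0 := Complex.slitPlane_ne_zero h2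
    field_simp
  have h1 : deriv χ 0 = k * deriv φ 0 := by
    simpa [hφ0, hχ0] using hode.eq_of_nhds
  refine ⟨h1, ?_⟩
  have h2 := hode.deriv_eq
  rw [(((hχ' 0).hasDerivAt.fun_mul (hφd 0).hasDerivAt)).deriv,
    (((hφ' 0).hasDerivAt.fun_mul (hχd 0).hasDerivAt).const_mul k).deriv, hφ0, hχ0, h1] at h2
  linear_combination h2

lemma deriv_charFun_map {Ω : Type*} [MeasurableSpace Ω] {P : Measure Ω} [IsProbabilityMeasure P]
    {X : Ω → ℝ} (hX : Measurable X) (h2 : MemLp X 2 P) :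
    ContDiff ℝ 2 (charFun (P.map X)) ∧
      deriv (charFun (P.map X)) 0 = Complex.I * (∫ ω, X ω ∂P : ℝ) ∧
      deriv (deriv (charFun (P.map X))) 0 = - ((∫ ω, X ω ^ 2 ∂P : ℝ) : ℂ) := by
  have : IsProbabilityMeasure (P.map X) := Measure.isProbabilityMeasure_map hX.aemeasurable
  have hm : MemLp id ((2 : ℕ) : ENNReal) (P.map X) :=
    (memLp_map_measure_iff aestronglyMeasurable_id hX.aemeasurable).2 (by simpa using h2)
  have hm1 : MemLp id ((1 : ℕ) : ENNReal) (P.map X) := hm.mono_exponent (by norm_num)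
  refine ⟨contDiff_charFun hm, ?_, ?_⟩
  · have := iteratedDeriv_charFun_zero hm1
    rw [iteratedDeriv_one] at this
    rw [this, integral_map hX.aemeasurable (by fun_prop)]
    simp
  · have := iteratedDeriv_charFun_zero hm
    rw [iteratedDeriv_succ, iteratedDeriv_one] at this
    rw [this, integral_map hX.aemeasurable (by fun_prop)]
    simp

/-- If `charFun X = exp ψ` and `charFun X' = exp (k ψ)`, the first two moments of `X'` are those of
a Lévy process with value `X` at time `1`, taken at time `k`. -/
lemma moments_of_charFun_eq_exp_mul {Ω Ω' : Type*} [MeasurableSpace Ω] [MeasurableSpace Ω']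
    {P : Measure Ω} [IsProbabilityMeasure P] {P' : Measure Ω'} [IsProbabilityMeasure P']
    {X : Ω → ℝ} {X' : Ω' → ℝ} (hX : Measurable X) (hX' : Measurable X') (h2 : MemLp X 2 P)
    (h2' : MemLp X' 2 P') {ψ : ℝ → ℂ} {k : ℝ} (hψ : ContinuousAt ψ 0) (hψ0 : ψ 0 = 0)
    (h : ∀ θ, charFun (P'.map X') θ = Complex.exp (ψ θ))
    (hk : ∀ θ, charFun (P.map X) θ = Complex.exp (k * ψ θ)) :
    ∫ ω, X ω ∂P = (∫ ω, X' ω ∂P') * k ∧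
      ∫ ω, X ω ^ 2 ∂P = Var[X'; P'] * k + (∫ ω, X' ω ∂P') ^ 2 * k ^ 2 := by
  obtain ⟨c1, d1, e1⟩ := deriv_charFun_map hX h2
  obtain ⟨c2, d2, e2⟩ := deriv_charFun_map hX' h2'
  obtain ⟨h1, h2⟩ := deriv_exp_mul_cumulant c2 c1 hψ hψ0 h hk
  rw [d1, d2] at h1
  rw [e1, e2, d2] at h2
  constructor
  · have : Complex.I * (∫ ω, X ω ∂P : ℝ) = Complex.I * (((∫ ω, X' ω ∂P') * k : ℝ) : ℂ) := by
      rw [h1]; push_cast; ring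
    exact_mod_cast mul_left_cancel₀ Complex.I_ne_zero this
  · rw [variance_eq_sub h2']
    have : ((∫ ω, X ω ^ 2 ∂P : ℝ) : ℂ) = (((∫ ω, X' ω ^ 2 ∂P' - (∫ ω, X' ω ∂P') ^ 2) * k
        + (∫ ω, X' ω ∂P') ^ 2 * k ^ 2 : ℝ) : ℂ) := by
      push_cast
      rw [mul_pow, Complex.I_sq] at h2
      linear_combination -h2
    exact_mod_cast this

/-! ### Second-order random measures -/

section SecondOrder

variable {S Ω : Type*} [MeasureSpace S] [MeasurableSpace Ω]

/-- The part of the structure of a square-integrable Lévy basis that is visible in its first two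
moments: `μ κ(E)` is the mean of `L E` and `v κ(E ∩ F)` is the covariance of `L E` and `L F`. -/
structure IsSecondOrder (P : Measure Ω) (L : Set S → Ω → ℝ) (κ : Measure S) (μ v : ℝ) : Prop where
  measurable : ∀ E, IsBddSet E → Measurable (L E)
  memLp : ∀ E, IsBddSet E → MemLp (L E) 2 P
  finite : ∀ E, IsBddSet E → κ E < ⊤
  mean : ∀ E, IsBddSet E → ∫ ω, L E ω ∂P = μ * κ.real E
  mul : ∀ E F, IsBddSet E → IsBddSet F →
    ∫ ω, L E ω * L F ω ∂P = v * κ.real (E ∩ F) + μ ^ 2 * (κ.real E * κ.real F)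

lemma IsBddSet.inter {E : Set S} (hE : IsBddSet E) {A : Set S} (hA : MeasurableSet A) :
    IsBddSet (A ∩ E) :=
  ⟨hA.inter hE.1, (measure_mono Set.inter_subset_right).trans_lt hE.2⟩

lemma IsBddSet.diff {E : Set S} (hE : IsBddSet E) {A : Set S} (hA : MeasurableSet A) :
    IsBddSet (E \ A) :=
  ⟨hE.1.diff hA, (measure_mono Set.sdiff_subset).trans_lt hE.2⟩

lemma IsBddSet.empty : IsBddSet (∅ : Set S) := ⟨.empty, by simp⟩

/-- Additivity over copies of ∅ makes n · L(∅) converge, so its increments L(∅) tend to 0. -/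
lemma IsLevyBasis.ae_eq_zero {P : Measure Ω} {L : Set S → Ω → ℝ} (hL : IsLevyBasis P L) :
    ∀ᵐ ω ∂P, L ∅ ω = 0 := by
  have h := hL.additive (fun _ => ∅) (fun _ => IsBddSet.empty) (fun _ _ _ => by simp)
    (by simpa using IsBddSet.empty)
  filter_upwards [h] with ω hω
  simp only [Finset.sum_const, Finset.card_range, nsmul_eq_mul, Set.iUnion_empty] at hω
  have h2 := ((tendsto_add_atTop_iff_nat 1).2 hω).sub hω
  simp only [Nat.cast_add, Nat.cast_one, add_mul, one_mul, add_sub_cancel_left, sub_self] at h2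
  exact tendsto_const_nhds_iff.1 h2

lemma IsLevyBasis.ae_add {P : Measure Ω} {L : Set S → Ω → ℝ} (hL : IsLevyBasis P L)
    {E F : Set S} (hE : IsBddSet E) (hF : IsBddSet F) (hEF : Disjoint E F) :
    ∀ᵐ ω ∂P, L (E ∪ F) ω = L E ω + L F ω := by
  let G : ℕ → Set S := fun n => if n = 0 then E else if n = 1 then F else ∅
  have hU : ⋃ n, G n = E ∪ F := by
    ext z
    simp only [Set.mem_iUnion, Set.mem_union, G]
    constructor
    · rintro ⟨n, hn⟩
      split_ifs at hn <;> simp_all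
    · rintro (h | h)
      · exact ⟨0, by simpa⟩
      · exact ⟨1, by simpa⟩
  have h := hL.additive G (fun n => by
      simp only [G]; split_ifs <;> [exact hE; exact hF; exact IsBddSet.empty])
    (fun i j hij => by
      simp only [G]; split_ifs <;> simp_all [hEF.symm])
    (by rw [hU]; exact ⟨hE.1.union hF.1, (measure_union_le _ _).trans_lt
      (ENNReal.add_lt_top.2 ⟨hE.2, hF.2⟩)⟩)
  filter_upwards [h, hL.ae_eq_zero] with ω hω h0
  rw [hU] at hω
  refine tendsto_nhds_unique hω (tendsto_const_nhds.congr' ?_)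
  filter_upwards [eventually_ge_atTop 2] with n hn
  obtain ⟨k, rfl⟩ := Nat.exists_eq_add_of_le hn
  rw [Finset.sum_range_add, Finset.sum_eq_zero (s := Finset.range k)]
  · simp [Finset.sum_range_succ, G]
  · intro i _
    have : 2 + i ≠ 1 := by omega
    simp [G, h0, this]

/-- Split E and F along E ∩ F. The square of L(E ∩ F) contributes its second moment; the three
remaining products factor by independence. -/
lemma IsLevyBasis.isSecondOrder {Ω' : Type*} [MeasurableSpace Ω'] {P : Measure Ω}
    [IsProbabilityMeasure P] {P' : Measure Ω'} [IsProbabilityMeasure P'] {L : Set S → Ω → ℝ}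
    (hL : IsLevyBasis P L) {a b : ℝ} {ν : Measure ℝ} {κ : Measure S}
    (hCQ : HasCharQuadruplet P L a b ν κ) (hL2 : HasFiniteSecondMoments P L) {L' : Ω' → ℝ}
    (hL' : IsLevySeed P' L' a b ν) (hvar : 0 < Var[L'; P']) :
    IsSecondOrder P L κ (∫ ω, L' ω ∂P') Var[L'; P'] := by
  -- Outside L² the variance takes the default value 0, so its positivity already forces
  -- square-integrability.
  have h2' : MemLp L' 2 P' := by
    by_contra h
    exact hvar.ne' (variance_of_not_memLp hL'.measurable.aestronglyMeasurable h)
  have hmom : ∀ E, IsBddSet E → _ := fun E hE =>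
    moments_of_charFun_eq_exp_mul (hL.measurable E hE) hL'.measurable (hL2 E hE) h2'
      (continuousAt_levyExponent a b hCQ.levyMeasure) (levyExponent_zero a b ν)
      hL'.charFun_eq (hCQ.charFun_eq E hE)
  have hprod : ∀ E F, IsBddSet E → IsBddSet F → Integrable (fun ω => L E ω * L F ω) P :=
    fun E F hE hF => (hL2 E hE).integrable_mul (hL2 F hF)
  have hdisj : ∀ E F, IsBddSet E → IsBddSet F → Disjoint E F →
      ∫ ω, L E ω * L F ω ∂P = (∫ ω, L' ω ∂P') ^ 2 * (κ.real E * κ.real F) := by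
    intro E F hE hF hEF
    rw [(hL.indep E F hE hF hEF).integral_fun_mul_eq_mul_integral
      (hL.measurable E hE).aestronglyMeasurable (hL.measurable F hF).aestronglyMeasurable,
      (hmom E hE).1, (hmom F hF).1]
    simp only [Measure.real]
    ring
  refine ⟨hL.measurable, hL2, hCQ.finite, fun E hE => (hmom E hE).1, fun E F hE hF => ?_⟩
  have hI : IsBddSet (E ∩ F) := hF.inter hE.1
  have hE' : IsBddSet (E \ F) := hE.diff hF.1
  have hF' : IsBddSet (F \ E) := hF.diff hE.1
  have d1 : Disjoint (E ∩ F) (E \ F) := Set.disjoint_sdiff_inter.symm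
  have d2 : Disjoint (E ∩ F) (F \ E) := by
    rw [Set.inter_comm]; exact Set.disjoint_sdiff_inter.symm
  have d3 : Disjoint (E \ F) (F \ E) := disjoint_sdiff_sdiff
  have aE := hL.ae_add hI hE' d1
  have aF := hL.ae_add hI hF' d2
  rw [Set.inter_union_sdiff] at aE
  rw [Set.inter_comm, Set.inter_union_sdiff, Set.inter_comm] at aF
  have kE : κ.real E = κ.real (E ∩ F) + κ.real (E \ F) :=
    (measureReal_inter_add_sdiff hF.1 (hCQ.finite E hE).ne).symm
  have kF : κ.real F = κ.real (E ∩ F) + κ.real (F \ E) := by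
    rw [Set.inter_comm]
    exact (measureReal_inter_add_sdiff hE.1 (hCQ.finite F hF).ne).symm
  have hexp : ∀ᵐ ω ∂P, L E ω * L F ω = L (E ∩ F) ω ^ 2 + L (E ∩ F) ω * L (F \ E) ω
      + L (E ∩ F) ω * L (E \ F) ω + L (E \ F) ω * L (F \ E) ω := by
    filter_upwards [aE, aF] with ω h1 h2
    rw [h1, h2]; ring
  have i1 : Integrable (fun ω => L (E ∩ F) ω ^ 2) P := (hL2 _ hI).integrable_sq
  have i2 : Integrable (fun ω => L (E ∩ F) ω ^ 2 + L (E ∩ F) ω * L (F \ E) ω) P :=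
    i1.add (hprod _ _ hI hF')
  have i3 : Integrable (fun ω => L (E ∩ F) ω ^ 2 + L (E ∩ F) ω * L (F \ E) ω
      + L (E ∩ F) ω * L (E \ F) ω) P := i2.add (hprod _ _ hI hE')
  rw [integral_congr_ae hexp, integral_add i3 (hprod _ _ hE' hF'),
    integral_add i2 (hprod _ _ hI hE'), integral_add i1 (hprod _ _ hI hF'), (hmom _ hI).2,
    hdisj _ _ hI hF' d2, hdisj _ _ hI hE' d1, hdisj _ _ hE' hF' d3, kE, kF]
  simp only [Measure.real]
  ring

end SecondOrder


/-! ### Integrals of linear combinations of indicators -/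

section StepComb

variable {S Ω : Type*} [MeasureSpace S] [MeasurableSpace Ω]

variable (S) in
/-- Formal linear combinations of Lebesgue-bounded sets. -/
abbrev StepComb : Type _ := {E : Set S // IsBddSet E} →₀ ℝ

namespace StepComb

/-- The function represented by a formal linear combination of sets. -/
def toFun : StepComb S →ₗ[ℝ] (S → ℝ) :=
  Finsupp.linearCombination ℝ fun E : {E : Set S // IsBddSet E} => E.1.indicator 1

/-- The integral of a formal linear combination of sets. -/
def integral (L : Set S → Ω → ℝ) : StepComb S →ₗ[ℝ] (Ω → ℝ) :=
  Finsupp.linearCombination ℝ fun E : {E : Set S // IsBddSet E} => L E.1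

/-- Restriction to a measurable set. -/
def restrict (A : Set S) (hA : MeasurableSet A) : StepComb S →ₗ[ℝ] StepComb S :=
  Finsupp.lmapDomain ℝ ℝ fun E : {E : Set S // IsBddSet E} => ⟨A ∩ E.1, E.2.inter hA⟩

@[simp]
lemma toFun_single (E : {E : Set S // IsBddSet E}) (y : ℝ) :
    toFun (Finsupp.single E y) = E.1.indicator fun _ => y := by
  ext z
  by_cases h : z ∈ E.1 <;> simp [toFun, h]

omit [MeasurableSpace Ω] in
@[simp]
lemma integral_single (L : Set S → Ω → ℝ) (E : {E : Set S // IsBddSet E}) (y : ℝ) :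
    integral L (Finsupp.single E y) = fun ω => y * L E.1 ω := by
  ext ω
  simp [integral]

@[simp]
lemma restrict_single (A : Set S) (hA : MeasurableSet A) (E : {E : Set S // IsBddSet E}) (y : ℝ) :
    restrict A hA (Finsupp.single E y) = Finsupp.single ⟨A ∩ E.1, E.2.inter hA⟩ y := by
  simp [restrict]

lemma toFun_restrict (A : Set S) (hA : MeasurableSet A) (u : StepComb S) :
    toFun (restrict A hA u) = A.indicator (toFun u) := by
  induction u using Finsupp.induction_linear with
  | zero => simp
  | add u w hu hw => rw [map_add, map_add, map_add, hu, hw, Set.indicator_add']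
  | single E y => rw [restrict_single, toFun_single, toFun_single, Set.indicator_indicator]

lemma measurable_toFun (u : StepComb S) : Measurable (toFun u) := by
  induction u using Finsupp.induction_linear with
  | zero => rw [map_zero]; exact measurable_const
  | add u w hu hw => rw [map_add]; exact hu.add hw
  | single E y => rw [toFun_single]; exact measurable_const.indicator E.2.1

variable {P : Measure Ω} {L : Set S → Ω → ℝ} {κ : Measure S} {μ v : ℝ}

lemma memLp_toFun (hM : IsSecondOrder P L κ μ v) (u : StepComb S) (p : ENNReal) :
    MemLp (toFun u) p κ := by
  induction u using Finsupp.induction_linear with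
  | zero => rw [map_zero]; exact MemLp.zero
  | add u w hu hw => rw [map_add]; exact hu.add hw
  | single E y =>
    rw [toFun_single]
    exact memLp_indicator_const p E.2.1 y (Or.inr (hM.finite _ E.2).ne)

lemma integrable_toFun (hM : IsSecondOrder P L κ μ v) (u : StepComb S) :
    Integrable (toFun u) κ :=
  memLp_one_iff_integrable.1 (memLp_toFun hM u 1)

lemma integrable_toFun_mul (hM : IsSecondOrder P L κ μ v) (u w : StepComb S) :
    Integrable (fun z => toFun u z * toFun w z) κ :=
  (memLp_toFun hM u 2).integrable_mul (memLp_toFun hM w 2)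

lemma measurable_integral (hM : IsSecondOrder P L κ μ v) (u : StepComb S) :
    Measurable (integral L u) := by
  induction u using Finsupp.induction_linear with
  | zero => rw [map_zero]; exact measurable_const
  | add u w hu hw => rw [map_add]; exact hu.add hw
  | single E y => rw [integral_single]; exact (hM.measurable _ E.2).const_mul y

lemma memLp_integral (hM : IsSecondOrder P L κ μ v) (u : StepComb S) :
    MemLp (integral L u) 2 P := by
  induction u using Finsupp.induction_linear with
  | zero => rw [map_zero]; exact MemLp.zero
  | add u w hu hw => rw [map_add]; exact hu.add hw
  | single E y => rw [integral_single]; exact (hM.memLp _ E.2).const_mul y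

lemma integrable_integral_mul (hM : IsSecondOrder P L κ μ v) (u w : StepComb S) :
    Integrable (fun ω => integral L u ω * integral L w ω) P :=
  (memLp_integral hM u).integrable_mul (memLp_integral hM w)

lemma mean_integral [IsFiniteMeasure P] (hM : IsSecondOrder P L κ μ v) (u : StepComb S) :
    ∫ ω, integral L u ω ∂P = μ * ∫ z, toFun u z ∂κ := by
  induction u using Finsupp.induction_linear with
  | zero => simp
  | add u w hu hw =>
    simp only [map_add, Pi.add_apply]
    rw [integral_add ((memLp_integral hM u).integrable one_le_two)
      ((memLp_integral hM w).integrable one_le_two), hu, hw,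
      integral_add (integrable_toFun hM u) (integrable_toFun hM w), mul_add]
  | single E y =>
    rw [integral_single, toFun_single, integral_const_mul, hM.mean _ E.2,
      integral_indicator_const _ E.2.1, smul_eq_mul]
    ring

/-- Both sides are bilinear in u and w, so single sets suffice. For u = w this is the isometry that
controls integrals in L². -/
lemma mul_integral (hM : IsSecondOrder P L κ μ v) (u w : StepComb S) :
    ∫ ω, integral L u ω * integral L w ω ∂P = v * ∫ z, toFun u z * toFun w z ∂κ
      + μ ^ 2 * ((∫ z, toFun u z ∂κ) * ∫ z, toFun w z ∂κ) := by
  induction u using Finsupp.induction_linear with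
  | zero => simp
  | add u u' hu hu' =>
    simp only [map_add, Pi.add_apply, add_mul]
    rw [integral_add (integrable_integral_mul hM u w) (integrable_integral_mul hM u' w), hu, hu',
      integral_add (integrable_toFun_mul hM u w) (integrable_toFun_mul hM u' w),
      integral_add (integrable_toFun hM u) (integrable_toFun hM u')]
    ring
  | single E y =>
    induction w using Finsupp.induction_linear with
    | zero => simp
    | add w w' hw hw' =>
      simp only [map_add, Pi.add_apply, mul_add]
      rw [integral_add (integrable_integral_mul hM _ w) (integrable_integral_mul hM _ w'), hw, hw',
        integral_add (integrable_toFun_mul hM _ w) (integrable_toFun_mul hM _ w'),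
        integral_add (integrable_toFun hM w) (integrable_toFun hM w')]
      ring
    | single F x =>
      have h1 : ∀ ω, y * L E.1 ω * (x * L F.1 ω) = (y * x) * (L E.1 ω * L F.1 ω) :=
        fun ω => by ring
      have h2 : ∀ z, E.1.indicator (fun _ => y) z * F.1.indicator (fun _ => x) z
          = (E.1 ∩ F.1).indicator (fun _ => y * x) z := fun z => by
        by_cases hE : z ∈ E.1 <;> by_cases hF : z ∈ F.1 <;> simp [hE, hF]
      simp only [integral_single, toFun_single, h1, h2]
      rw [integral_const_mul, hM.mul _ _ E.2 F.2, integral_indicator_const _ (E.2.1.inter F.2.1),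
        integral_indicator_const _ E.2.1, integral_indicator_const _ F.2.1]
      simp only [smul_eq_mul]
      ring

lemma tendsto_eLpNorm_integral (hM : IsSecondOrder P L κ μ v) {ι : Type*} {l : Filter ι}
    {w : ι → StepComb S} (h1 : Tendsto (fun i => ∫ z, toFun (w i) z ∂κ) l (𝓝 0))
    (h2 : Tendsto (fun i => ∫ z, toFun (w i) z ^ 2 ∂κ) l (𝓝 0)) :
    Tendsto (fun i => eLpNorm (integral L (w i)) 2 P) l (𝓝 0) := by
  have h3 : Tendsto (fun i => ∫ ω, integral L (w i) ω ^ 2 ∂P) l (𝓝 0) := by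
    have h := (h2.const_mul v).add ((h1.mul h1).const_mul (μ ^ 2))
    simp only [mul_zero, add_zero] at h
    refine h.congr fun i => ?_
    simp only [sq (toFun _ _), sq (integral _ _ _), mul_integral hM]
  have h4 : ∀ i, eLpNorm (integral L (w i)) 2 P
      = ENNReal.ofReal ((∫ ω, integral L (w i) ω ^ 2 ∂P) ^ (2⁻¹ : ℝ)) := fun i => by
    rw [(memLp_integral hM (w i)).eLpNorm_eq_integral_rpow_norm two_ne_zero ENNReal.ofNat_ne_top]
    simp
  simp only [h4]
  have h5 := (Real.continuous_rpow_const (q := 2⁻¹) (by norm_num)).tendsto' 0 0 (by simp)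
  simpa using ENNReal.tendsto_ofReal (h5.comp h3)

end StepComb

/-! ### Convergence in probability through the expectation of the truncated modulus -/

/-- The expectation of `min 1 |X|`. -/
def probNorm (P : Measure Ω) (X : Ω → ℝ) : ENNReal := ∫⁻ ω, min 1 ‖X ω‖ₑ ∂P

/-- Subadditivity lets convergence in probability be handled by triangle inequalities, as with a
seminorm. -/
lemma probNorm_add_le {P : Measure Ω} {X Y : Ω → ℝ} (hX : AEMeasurable X P) :
    probNorm P (X + Y) ≤ probNorm P X + probNorm P Y := by
  unfold probNorm
  rw [← lintegral_add_left' (by fun_prop)]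
  refine lintegral_mono fun ω => ?_
  have h : ‖(X + Y) ω‖ₑ ≤ ‖X ω‖ₑ + ‖Y ω‖ₑ := enorm_add_le _ _
  rcases le_total 1 ‖X ω‖ₑ with hx | hx
  · rw [min_eq_left hx]
    exact (min_le_left _ _).trans le_self_add
  · rcases le_total 1 ‖Y ω‖ₑ with hy | hy
    · rw [min_eq_left hy]
      exact (min_le_left _ _).trans le_add_self
    · rw [min_eq_right hx, min_eq_right hy]
      exact (min_le_right _ _).trans h

lemma probNorm_neg (P : Measure Ω) (X : Ω → ℝ) : probNorm P (-X) = probNorm P X := by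
  simp [probNorm]

lemma probNorm_sub_comm (P : Measure Ω) (X Y : Ω → ℝ) :
    probNorm P (X - Y) = probNorm P (Y - X) := by
  rw [← probNorm_neg, neg_sub]

lemma probNorm_le_eLpNorm {P : Measure Ω} [IsProbabilityMeasure P] {X : Ω → ℝ}
    (hX : Measurable X) : probNorm P X ≤ eLpNorm X 2 P :=
  calc probNorm P X ≤ ∫⁻ ω, ‖X ω‖ₑ ∂P := lintegral_mono fun _ => min_le_right _ _
    _ = eLpNorm X 1 P := eLpNorm_one_eq_lintegral_enorm.symm
    _ ≤ eLpNorm X 2 P :=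
      eLpNorm_le_eLpNorm_of_exponent_le one_le_two hX.aestronglyMeasurable

lemma tendsto_probNorm_sub_of_tendstoInMeasure {P : Measure Ω} [IsProbabilityMeasure P]
    {ι : Type*} {l : Filter ι} {f : ι → Ω → ℝ} {g : Ω → ℝ} (h : TendstoInMeasure P f l g) :
    Tendsto (fun i => probNorm P (f i - g)) l (𝓝 0) := by
  rw [ENNReal.tendsto_nhds_zero]
  intro ε hε
  have h2 : (0 : ENNReal) < ε / 2 := ENNReal.half_pos hε.ne'
  filter_upwards [ENNReal.tendsto_nhds_zero.1 (tendstoInMeasure_iff_enorm.1 h (min 1 (ε / 2))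
    (lt_min one_pos h2) (ne_top_of_le_ne_top ENNReal.one_ne_top (min_le_left _ _))) _ h2] with i hi
  -- Off this exceptional set the modulus is at most ε / 2; on it the truncation at 1 leaves only
  -- its probability.
  set s := {x | min 1 (ε / 2) ≤ ‖f i x - g x‖ₑ}
  calc probNorm P (f i - g) ≤ ∫⁻ ω, (ε / 2 + s.indicator 1 ω) ∂P := by
        refine lintegral_mono fun ω => ?_
        by_cases hω : ω ∈ s
        · simp only [Set.indicator_of_mem hω, Pi.one_apply]
          exact (min_le_left _ _).trans le_add_self
        · simp only [Set.indicator_of_notMem hω, add_zero]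
          exact (min_le_right _ _).trans ((not_le.1 hω).le.trans (min_le_right _ _))
    _ = ε / 2 + ∫⁻ ω, s.indicator 1 ω ∂P := by
        rw [lintegral_add_left measurable_const]; simp
    _ ≤ ε / 2 + ε / 2 := by gcongr; exact (lintegral_indicator_one_le s).trans hi
    _ = ε := ENNReal.add_halves ε

lemma ae_eq_of_probNorm_sub_eq_zero {P : Measure Ω} {X Y : Ω → ℝ} (hX : AEMeasurable X P)
    (hY : AEMeasurable Y P) (h : probNorm P (X - Y) = 0) : X =ᵐ[P] Y := by
  rw [probNorm, lintegral_eq_zero_iff' (by fun_prop)] at h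
  filter_upwards [h] with ω hω
  simp only [Pi.sub_apply, Pi.zero_apply] at hω
  rcases min_choice (1 : ENNReal) ‖X ω - Y ω‖ₑ with h | h <;> rw [h] at hω
  · exact absurd hω one_ne_zero
  · exact sub_eq_zero.1 (enorm_eq_zero.1 hω)

end StepComb


/-! ### Uniqueness of the stochastic integral -/

section Uniqueness

variable {S Ω : Type*} [MeasureSpace S] [MeasurableSpace Ω]
variable {P : Measure Ω} [IsProbabilityMeasure P] {L : Set S → Ω → ℝ} {κ : Measure S} {μ v : ℝ}

namespace StepComb

omit [IsProbabilityMeasure P] in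
lemma probNorm_add_le (hM : IsSecondOrder P L κ μ v) (u w : StepComb S) :
    probNorm P (integral L (u + w)) ≤ probNorm P (integral L u) + probNorm P (integral L w) := by
  rw [map_add]
  exact MSTOU.probNorm_add_le (measurable_integral hM u).aemeasurable

omit [IsProbabilityMeasure P] in
lemma probNorm_sub_le (hM : IsSecondOrder P L κ μ v) (u w : StepComb S) :
    probNorm P (integral L (u - w)) ≤ probNorm P (integral L u) + probNorm P (integral L w) := by
  rw [sub_eq_add_neg]
  refine (probNorm_add_le hM u (-w)).trans_eq ?_
  rw [map_neg, probNorm_neg]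

omit [IsProbabilityMeasure P] in
/-- Dominated convergence for integrals of step functions. -/
lemma tendsto_eLpNorm_integral_of_dominated (hM : IsSecondOrder P L κ μ v) {ι : Type*}
    {l : Filter ι} [l.IsCountablyGenerated] {w : ι → StepComb S} {G : S → ℝ}
    (hG : Integrable G κ) (hG2 : Integrable (fun z => G z ^ 2) κ)
    (hb : ∀ i, ∀ᵐ z ∂κ, |toFun (w i) z| ≤ G z)
    (ht : ∀ᵐ z ∂κ, Tendsto (fun i => toFun (w i) z) l (𝓝 0)) :
    Tendsto (fun i => eLpNorm (integral L (w i)) 2 P) l (𝓝 0) := by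
  refine tendsto_eLpNorm_integral hM ?_ ?_
  · have := tendsto_integral_filter_of_dominated_convergence G
      (Eventually.of_forall fun i => (measurable_toFun (w i)).aestronglyMeasurable)
      (Eventually.of_forall hb) hG ht
    simpa using this
  · have := tendsto_integral_filter_of_dominated_convergence (F := fun i z => toFun (w i) z ^ 2)
      (f := fun _ => 0) (fun z => G z ^ 2) (Eventually.of_forall
        fun i => ((measurable_toFun (w i)).pow_const 2).aestronglyMeasurable)
      (Eventually.of_forall fun i => by
        filter_upwards [hb i] with z hz
        rw [norm_pow]
        exact pow_le_pow_left₀ (norm_nonneg _) hz 2) hG2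
      (by
        filter_upwards [ht] with z hz
        simpa using hz.pow 2)
    simpa using this

lemma tendsto_probNorm_integral_of_dominated (hM : IsSecondOrder P L κ μ v) {ι : Type*}
    {l : Filter ι} [l.IsCountablyGenerated] {w : ι → StepComb S} {G : S → ℝ}
    (hG : Integrable G κ) (hG2 : Integrable (fun z => G z ^ 2) κ)
    (hb : ∀ i, ∀ᵐ z ∂κ, |toFun (w i) z| ≤ G z)
    (ht : ∀ᵐ z ∂κ, Tendsto (fun i => toFun (w i) z) l (𝓝 0)) :
    Tendsto (fun i => probNorm P (integral L (w i))) l (𝓝 0) :=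
  tendsto_of_tendsto_of_tendsto_of_le_of_le tendsto_const_nhds
    (tendsto_eLpNorm_integral_of_dominated hM hG hG2 hb ht)
    (fun _ => zero_le) fun i => probNorm_le_eLpNorm (measurable_integral hM (w i))

/-- Dominated convergence for a constant sequence with bound 0. Formal combinations representing the
same function thus have the same integral almost surely, so identities between functions transfer to
integrals. -/
lemma probNorm_integral_eq_zero (hM : IsSecondOrder P L κ μ v) {w : StepComb S}
    (hw : ∀ᵐ z ∂κ, toFun w z = 0) : probNorm P (integral L w) = 0 := by
  have h := tendsto_probNorm_integral_of_dominated hM (l := atTop (α := ℕ)) (w := fun _ => w) (G := 0)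
    (integrable_zero _ _ _) (by simp)
    (fun _ => by filter_upwards [hw] with z hz; simp [hz])
    (by filter_upwards [hw] with z hz; simp [hz])
  exact tendsto_nhds_unique tendsto_const_nhds h

/-- Continuity of the indefinite integral of a fixed step function under pointwise convergence of
sets, with |w| as dominating function. -/
lemma tendsto_probNorm_restrict_sub (hM : IsSecondOrder P L κ μ v) (w : StepComb S)
    {B : ℕ → Set S} {C : Set S} (hB : ∀ n, MeasurableSet (B n)) (hC : MeasurableSet C)
    (hBC : ∀ z, ∀ᶠ n in atTop, z ∈ B n ↔ z ∈ C) :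
    Tendsto (fun n => probNorm P (integral L (restrict (B n) (hB n) w - restrict C hC w)))
      atTop (𝓝 0) := by
  refine tendsto_probNorm_integral_of_dominated hM (integrable_toFun hM w).norm ?_ ?_ ?_
  · simpa [sq] using integrable_toFun_mul hM w w
  · refine fun n => Eventually.of_forall fun z => ?_
    rw [map_sub, toFun_restrict, toFun_restrict, Pi.sub_apply]
    by_cases h1 : z ∈ B n <;> by_cases h2 : z ∈ C <;> simp [h1, h2]
  · refine Eventually.of_forall fun z => tendsto_const_nhds.congr' ?_
    filter_upwards [hBC z] with n hn
    rw [map_sub, toFun_restrict, toFun_restrict, Pi.sub_apply]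
    by_cases h : z ∈ C <;> simp [h, hn]

/-- The preimage of a set of levels, given by its indicator, under a level function. -/
def levelSet (lev : S → ℕ) (T : ℕ → Bool) : Set S := {z | T (lev z) = true}

lemma measurableSet_levelSet {lev : S → ℕ} (hlev : Measurable lev) (T : ℕ → Bool) :
    MeasurableSet (levelSet lev T) :=
  hlev (MeasurableSet.of_discrete (s := {k | T k = true}))

/-- In the metrizable space `ℕ → Bool` it suffices to test sequences. Convergence there means
eventual agreement at each level, hence pointwise convergence of the level sets. -/
lemma isClosed_probNorm_levelSet_le (hM : IsSecondOrder P L κ μ v) {lev : S → ℕ}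
    (hlev : Measurable lev) (w : StepComb S) (ε : ENNReal) :
    IsClosed {T : ℕ → Bool | probNorm P (integral L
      (restrict (levelSet lev T) (measurableSet_levelSet hlev T) w)) ≤ ε} := by
  refine IsSeqClosed.isClosed fun T T₀ hT hlim => ?_
  have h := tendsto_probNorm_restrict_sub hM w
    (fun n => measurableSet_levelSet hlev (T n)) (measurableSet_levelSet hlev T₀) (fun z => by
      have h1 := tendsto_pi_nhds.1 hlim (lev z)
      rw [nhds_discrete, tendsto_pure] at h1
      filter_upwards [h1] with n hn
      simp [levelSet, hn])
  have h2 : Tendsto (fun n => ε + probNorm P (integral L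
      (restrict (levelSet lev (T n)) (measurableSet_levelSet hlev (T n)) w
        - restrict (levelSet lev T₀) (measurableSet_levelSet hlev T₀) w))) atTop (𝓝 ε) := by
    simpa using tendsto_const_nhds.add h
  refine ge_of_tendsto' h2 fun n => ?_
  refine le_trans ?_ (add_le_add_left (hT n) _)
  refine le_trans (le_of_eq ?_) (probNorm_sub_le hM _ _)
  rw [sub_sub_cancel]

/-- A Vitali–Hahn–Saks type statement: integrals that form a Cauchy sequence in probability over
every measurable set have uniformly small tails. -/
lemma exists_forall_probNorm_tail_le (hM : IsSecondOrder P L κ μ v) {lev : S → ℕ}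
    (hlev : Measurable lev) {u : ℕ → StepComb S}
    (hc : ∀ (A : Set S) (hA : MeasurableSet A), Tendsto (fun p : ℕ × ℕ =>
      probNorm P (integral L (restrict A hA (u p.1 - u p.2)))) atTop (𝓝 0))
    {ε : ENNReal} (hε : 0 < ε) :
    ∃ N K, ∀ n ≥ N, ∀ k ≥ K, probNorm P (integral L
      (restrict {z | k ≤ lev z} (hlev measurableSet_Ici) (u n - u N))) ≤ ε + ε := by
  -- Level selections over which all increments after N are small. The Cauchy hypothesis makes these
  -- closed sets cover `ℕ → Bool`, so by Baire one contains a cylinder fixing only levels below some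
  -- K.
  let F : ℕ → Set (ℕ → Bool) := fun N => ⋂ n ≥ N, {T | probNorm P (integral L
      (restrict (levelSet lev T) (measurableSet_levelSet hlev T) (u n - u N))) ≤ ε}
  have hF : ∀ N, IsClosed (F N) := fun N => isClosed_biInter fun n _ =>
    isClosed_probNorm_levelSet_le hM hlev _ ε
  have hU : ⋃ N, F N = Set.univ := by
    refine Set.eq_univ_of_forall fun T => ?_
    obtain ⟨⟨a, b⟩, hab⟩ := eventually_atTop.1
      (ENNReal.tendsto_nhds_zero.1 (hc (levelSet lev T) (measurableSet_levelSet hlev T)) ε hε)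
    refine Set.mem_iUnion.2 ⟨max a b, Set.mem_iInter₂.2 fun n hn => ?_⟩
    exact hab (n, max a b) ⟨(le_max_left a b).trans hn, le_max_right a b⟩
  obtain ⟨N, T₀, hT₀⟩ := nonempty_interior_of_iUnion_of_closed hF hU
  obtain ⟨I, U, hIU, hsub⟩ := isOpen_pi_iff.1 isOpen_interior T₀ hT₀
  obtain ⟨K, hK⟩ : ∃ K, ∀ i ∈ I, i < K := ⟨I.sup id + 1, fun i hi =>
    Nat.lt_succ_of_le (Finset.le_sup (f := id) hi)⟩
  have hcyl : ∀ T : ℕ → Bool, (∀ j < K, T j = T₀ j) → T ∈ F N := fun T hT =>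
    interior_subset (hsub fun i hi => by rw [hT i (hK i hi)]; exact (hIU i hi).2)
  refine ⟨N, K, fun n hn k hk => ?_⟩
  -- Both selections lie in the cylinder, and they differ exactly by the levels from k on.
  -- Subtracting them isolates the tail at cost ε + ε.
  let T₁ : ℕ → Bool := fun j => if j < K then T₀ j else false
  let T₂ : ℕ → Bool := fun j => if j < K then T₀ j else decide (k ≤ j)
  have h1 := Set.mem_iInter₂.1 (hcyl T₁ fun j hj => by simp [T₁, hj]) n hn
  have h2 := Set.mem_iInter₂.1 (hcyl T₂ fun j hj => by simp [T₂, hj]) n hn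
  have hfun : ∀ w, toFun (restrict {z | k ≤ lev z} (hlev measurableSet_Ici) w
      - (restrict (levelSet lev T₂) (measurableSet_levelSet hlev T₂) w
        - restrict (levelSet lev T₁) (measurableSet_levelSet hlev T₁) w)) = 0 := by
    intro w
    simp only [map_sub, toFun_restrict]
    ext z
    simp only [Pi.sub_apply, Pi.zero_apply, Set.indicator_apply, levelSet, Set.mem_ofPred_eq, T₁,
      T₂]
    by_cases hz : lev z < K
    · have hz' : ¬ k ≤ lev z := by omega
      simp [hz, hz']
    · simp [hz]
  have h0 := probNorm_integral_eq_zero hM (Eventually.of_forall fun z => congrFun (hfun (u n - u N)) z)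
  have h3 := probNorm_add_le hM _ _ |>.trans (add_le_add h0.le ((probNorm_sub_le hM _ _).trans
    (add_le_add h2 h1)))
  rwa [sub_add_cancel, zero_add] at h3

omit [IsProbabilityMeasure P] in
-- The level combines the index of a spanning set with a bound for the whole sequence. Below level k
-- the step functions are therefore dominated by a constant on a set of finite κ-measure.
lemma exists_level (hM : IsSecondOrder P L κ μ v) [SigmaFinite (volume : Measure S)]
    {u : ℕ → StepComb S} (hu : ∀ᵐ z ∂κ, Tendsto (fun n => toFun (u n) z) atTop (𝓝 0)) :
    ∃ lev : S → ℕ, Measurable lev ∧ (∀ k, κ {z | lev z < k} < ⊤) ∧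
      ∀ᵐ z ∂κ, ∀ n, |toFun (u n) z| ≤ lev z := by
  refine ⟨fun z => max (spanningSetsIndex (volume : Measure S) z) ⌈⨆ n, |toFun (u n) z|⌉₊,
    ?_, fun k => ?_, ?_⟩
  · refine (measurableSet_spanningSetsIndex _).max (Nat.measurable_ceil.comp ?_)
    exact Measurable.iSup fun n => continuous_abs.measurable.comp (measurable_toFun (u n))
  · refine (measure_mono fun z hz => ?_).trans_lt (hM.finite _
      ⟨measurableSet_spanningSets volume k, measure_spanningSets_lt_top volume k⟩)
    exact mem_spanningSets_of_index_le _ _ ((le_max_left _ _).trans (le_of_lt hz))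
  · filter_upwards [hu] with z hz n
    -- An unbounded real supremum would be the default 0; convergence at z rules this out.
    have hb : BddAbove (Set.range fun n => |toFun (u n) z|) := hz.abs.bddAbove_range
    refine (le_ciSup hb n).trans ((Nat.le_ceil _).trans ?_)
    exact_mod_cast le_max_right _ _

/-- If step functions converge to `0` almost everywhere and their integrals over every measurable
set form a Cauchy sequence in probability, then their integrals converge to `0`. -/
theorem tendsto_probNorm_of_ae_tendsto_zero (hM : IsSecondOrder P L κ μ v)
    [SigmaFinite (volume : Measure S)] {u : ℕ → StepComb S}
    (hu : ∀ᵐ z ∂κ, Tendsto (fun n => toFun (u n) z) atTop (𝓝 0))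
    (hc : ∀ (A : Set S) (hA : MeasurableSet A), Tendsto (fun p : ℕ × ℕ =>
      probNorm P (integral L (restrict A hA (u p.1 - u p.2)))) atTop (𝓝 0)) :
    Tendsto (fun n => probNorm P (integral L (u n))) atTop (𝓝 0) := by
  obtain ⟨lev, hlev, hfin, hbd⟩ := exists_level hM hu
  rw [ENNReal.tendsto_nhds_zero]
  intro ε hε
  -- One quarter for the part below level k, two for the tail of u n - u N, one for the tail of u N.
  have hδ : 0 < ε / 4 := ENNReal.div_pos hε.ne' (by norm_num)
  obtain ⟨N, K, hNK⟩ := exists_forall_probNorm_tail_le hM hlev hc hδ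
  have htail := tendsto_probNorm_restrict_sub hM (u N)
    (B := fun k => {z | k ≤ lev z}) (C := ∅) (fun k => hlev measurableSet_Ici) .empty
    (fun z => by
      filter_upwards [eventually_gt_atTop (lev z)] with k hk
      simpa using hk)
  -- Since N is already fixed, k can be enlarged until the tail of the single function u N is small.
  obtain ⟨k, hk, hkN⟩ := ((eventually_ge_atTop K).and
    (ENNReal.tendsto_nhds_zero.1 htail _ hδ)).exists
  have hE : MeasurableSet {z | k ≤ lev z} := hlev measurableSet_Ici
  have hA : MeasurableSet {z | lev z < k} := hlev measurableSet_Iio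
  have hmain : Tendsto (fun n => probNorm P (integral L (restrict {z | lev z < k} hA (u n))))
      atTop (𝓝 0) := by
    refine tendsto_probNorm_integral_of_dominated hM
      (G := {z | lev z < k}.indicator fun _ => (k : ℝ)) ?_ ?_ (fun n => ?_) ?_
    · exact (integrable_indicator_iff hA).2 (integrableOn_const (hfin k).ne)
    · have : (fun z => ({z | lev z < k}.indicator (fun _ => (k : ℝ)) z) ^ 2)
          = {z | lev z < k}.indicator fun _ => (k : ℝ) ^ 2 := by
        ext z
        by_cases h : lev z < k <;> simp [h]
      rw [this]
      exact (integrable_indicator_iff hA).2 (integrableOn_const (hfin k).ne)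
    · filter_upwards [hbd] with z hz
      rw [toFun_restrict]
      by_cases h : lev z < k
      · simp only [Set.indicator_apply, Set.mem_ofPred_eq, h, if_true]
        exact (hz n).trans (by exact_mod_cast h.le)
      · simp [h]
    · filter_upwards [hu] with z hz
      simp only [toFun_restrict]
      by_cases h : lev z < k
      · simpa [h] using hz
      · simp [h]
  filter_upwards [ENNReal.tendsto_nhds_zero.1 hmain _ hδ, eventually_ge_atTop N] with n hn hnN
  have hfun : toFun (u n - (restrict {z | lev z < k} hA (u n)
      + (restrict _ hE (u n - u N) + (restrict _ hE (u N) - restrict ∅ .empty (u N))))) = 0 := by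
    simp only [map_sub, map_add, toFun_restrict]
    ext z
    by_cases h : lev z < k
    · simp [h]
    · simp [h, not_lt.1 h]
  have h0 := probNorm_integral_eq_zero hM (Eventually.of_forall fun z => congrFun hfun z)
  have hsum := (probNorm_add_le hM _ _).trans (add_le_add h0.le ((probNorm_add_le hM _ _).trans
    (add_le_add hn ((probNorm_add_le hM _ _).trans (add_le_add (hNK n hnN k hk) hkN)))))
  rw [sub_add_cancel] at hsum
  refine hsum.trans_eq ?_
  have h4 : ε / 4 + (ε / 4 + ε / 4 + ε / 4) = 4 * (ε / 4) := by ring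
  rw [zero_add, h4]
  exact ENNReal.mul_div_cancel (by norm_num) (by finiteness)

end StepComb

end Uniqueness


/-! ### Moments of stochastic integrals -/

section StochIntegral

variable {S Ω : Type*} [MeasureSpace S] [MeasurableSpace Ω]
variable {P : Measure Ω} {L : Set S → Ω → ℝ} {κ : Measure S} {μ v : ℝ}

/-- A simple integrand as a formal linear combination of sets. -/
def SimpleIntegrand.toStepComb (h : SimpleIntegrand S) : StepComb S :=
  ∑ j, Finsupp.single ⟨h.set j, h.bdd j⟩ (h.coeff j)

lemma SimpleIntegrand.toFun_toStepComb (h : SimpleIntegrand S) :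
    StepComb.toFun h.toStepComb = h.toFun := by
  ext z
  simp [toStepComb, SimpleIntegrand.toFun]

omit [MeasurableSpace Ω] in
lemma SimpleIntegrand.integral_restrict_toStepComb (h : SimpleIntegrand S) {A : Set S}
    (hA : MeasurableSet A) :
    StepComb.integral L (StepComb.restrict A hA h.toStepComb) = h.integral L A := by
  ext ω
  simp [toStepComb, SimpleIntegrand.integral]

omit [MeasurableSpace Ω] in
lemma SimpleIntegrand.integral_toStepComb (h : SimpleIntegrand S) :
    StepComb.integral L h.toStepComb = h.integral L Set.univ := by
  ext ω
  simp [toStepComb, SimpleIntegrand.integral]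

/-- Simple approximations are cut off to spanning sets to make their fibres Lebesgue-bounded. The
factor 2 is the norm bound of `SimpleFunc.approxOn`. -/
lemma exists_stepComb_tendsto [SigmaFinite (volume : Measure S)] {g : S → ℝ} (hg : Measurable g) :
    ∃ w : ℕ → StepComb S, (∀ z, Tendsto (fun n => StepComb.toFun (w n) z) atTop (𝓝 (g z))) ∧
      ∀ n z, |StepComb.toFun (w n) z| ≤ 2 * |g z| := by
  let s : ℕ → SimpleFunc S ℝ := SimpleFunc.approxOn g hg Set.univ 0 (Set.mem_univ 0)
  let w : ℕ → StepComb S := fun n => ∑ y ∈ (s n).range, Finsupp.single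
    ⟨s n ⁻¹' {y} ∩ spanningSets volume n, IsBddSet.inter
      ⟨measurableSet_spanningSets volume n, measure_spanningSets_lt_top volume n⟩
      ((s n).measurableSet_fiber y)⟩ y
  have hw : ∀ n z, StepComb.toFun (w n) z = (spanningSets volume n).indicator (s n) z := by
    intro n z
    simp only [w, map_sum, StepComb.toFun_single, Finset.sum_apply]
    by_cases hz : z ∈ spanningSets (volume : Measure S) n
    · rw [Finset.sum_eq_single (s n z)]
      · simp [hz]
      · intro y _ hy
        simp [hy.symm]
      · intro h
        exact absurd (SimpleFunc.mem_range_self _ _) h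
    · simp [hz]
  refine ⟨w, fun z => ?_, fun n z => ?_⟩
  · have h1 : Tendsto (fun n => s n z) atTop (𝓝 (g z)) :=
      SimpleFunc.tendsto_approxOn hg (Set.mem_univ 0) (by simp)
    refine h1.congr' ?_
    filter_upwards [eventually_ge_atTop (spanningSetsIndex volume z)] with n hn
    rw [hw, Set.indicator_of_mem (mem_spanningSets_of_index_le _ _ hn)]
  · rw [hw]
    have h1 : ‖s n z‖ ≤ ‖g z‖ + ‖g z‖ := SimpleFunc.norm_approxOn_zero_le hg _ z n
    rw [Real.norm_eq_abs, Real.norm_eq_abs] at h1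
    by_cases hz : z ∈ spanningSets (volume : Measure S) n
    · rw [Set.indicator_of_mem hz]; linarith
    · rw [Set.indicator_of_notMem hz, abs_zero]; positivity

open StepComb in
/-- The stochastic integral of a function that is integrable and square-integrable is the
`L²`-limit of the integrals of dominated step functions. -/
theorem IsStochIntegral.exists_tendsto_toLp [IsProbabilityMeasure P]
    [SigmaFinite (volume : Measure S)] (hM : IsSecondOrder P L κ μ v) {g : S → ℝ} {Y : Ω → ℝ}
    (hY : IsStochIntegral P L κ g Set.univ Y) (hg : Integrable g κ)
    (hg2 : Integrable (fun z => g z ^ 2) κ) :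
    ∃ (w : ℕ → StepComb S) (hL2 : MemLp Y 2 P),
      (∀ z, Tendsto (fun n => toFun (w n) z) atTop (𝓝 (g z))) ∧
      (∀ n z, |toFun (w n) z| ≤ 2 * |g z|) ∧
      Tendsto (fun n => (memLp_integral hM (w n)).toLp) atTop (𝓝 (hL2.toLp Y)) := by
  obtain ⟨hgm, h, happ, hlim⟩ := hY
  obtain ⟨w, hw, hwg⟩ := exists_stepComb_tendsto hgm
  have hG : Integrable (fun z => 4 * |g z|) κ := hg.abs.const_mul 4
  have hG2 : Integrable (fun z => (4 * |g z|) ^ 2) κ := by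
    simpa [mul_pow] using hg2.const_mul (4 ^ 2)
  have hwb : ∀ p : ℕ × ℕ, ∀ z, |toFun (w p.1 - w p.2) z| ≤ 4 * |g z| := fun p z => by
    rw [map_sub, Pi.sub_apply]
    have := abs_sub (toFun (w p.1) z) (toFun (w p.2) z)
    linarith [hwg p.1 z, hwg p.2 z]
  have hwt : ∀ z, Tendsto (fun p : ℕ × ℕ => toFun (w p.1 - w p.2) z) atTop (𝓝 0) := fun z => by
    rw [← prod_atTop_atTop_eq]
    simpa using ((hw z).comp tendsto_fst).sub ((hw z).comp tendsto_snd)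
  have hcauchy : CauchySeq fun n => (memLp_integral hM (w n)).toLp := by
    rw [cauchySeq_iff_tendsto_dist_atTop_0]
    have h1 := tendsto_eLpNorm_integral_of_dominated hM hG hG2
      (fun p => Eventually.of_forall (hwb p)) (Eventually.of_forall hwt)
    refine ((ENNReal.tendsto_toReal ENNReal.zero_ne_top).comp h1).congr fun p => ?_
    rw [Lp.dist_edist, Lp.edist_toLp_toLp, Function.comp_apply, map_sub]
  obtain ⟨Z, hZ⟩ := cauchySeq_tendsto_of_complete hcauchy
  have hZm : Tendsto (fun n => probNorm P (integral L (w n) - Z)) atTop (𝓝 0) :=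
    tendsto_probNorm_sub_of_tendstoInMeasure
      ((tendstoInMeasure_of_tendsto_Lp hZ).congr_left fun n => MemLp.coeFn_toLp _)
  have hmeas : ∀ A, MeasurableSet A → ∀ n, Measurable ((h n).integral L A) := fun A hA n => by
    rw [← SimpleIntegrand.integral_restrict_toStepComb _ hA]
    exact measurable_integral hM _
  -- Over each A, the given sequence is Cauchy in probability by hypothesis and the dominated one by
  -- the isometry; hence so is their difference, which tends to 0 almost everywhere.
  have hsub : ∀ (A : Set S) (hA : MeasurableSet A), Tendsto (fun p : ℕ × ℕ =>
      probNorm P (integral L (restrict A hA (((h p.1).toStepComb - w p.1)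
        - ((h p.2).toStepComb - w p.2))))) atTop (𝓝 0) := by
    intro A hA
    obtain ⟨ZA, hZA⟩ := happ.tendstoInMeasure A hA
    have hZAm : AEMeasurable ZA P := hZA.aemeasurable fun n => (hmeas A hA n).aemeasurable
    have hn := tendsto_probNorm_sub_of_tendstoInMeasure hZA
    have hn1 : Tendsto (fun p : ℕ × ℕ => probNorm P ((h p.1).integral L A - ZA)) atTop (𝓝 0) := by
      rw [← prod_atTop_atTop_eq]; exact hn.comp tendsto_fst
    have hn2 : Tendsto (fun p : ℕ × ℕ => probNorm P (ZA - (h p.2).integral L A)) atTop (𝓝 0) := by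
      rw [← prod_atTop_atTop_eq]
      exact (hn.comp tendsto_snd).congr fun p => probNorm_sub_comm _ _ _
    have hn3 := tendsto_probNorm_integral_of_dominated (P := P) hM
      (w := fun p : ℕ × ℕ => restrict A hA (w p.2 - w p.1)) (l := atTop) hG hG2
      (fun p => Eventually.of_forall fun z => by
        rw [toFun_restrict]
        by_cases hz : z ∈ A
        · rw [Set.indicator_of_mem hz]; exact hwb (p.2, p.1) z
        · rw [Set.indicator_of_notMem hz, abs_zero]; positivity)
      (Eventually.of_forall fun z => by
        simp only [toFun_restrict]
        by_cases hz : z ∈ A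
        · simp only [Set.indicator_of_mem hz]
          simpa only [map_sub, Pi.sub_apply, neg_sub, neg_zero] using (hwt z).neg
        · simp [hz])
    have hn4 := (hn1.add hn2).add hn3
    rw [add_zero, add_zero] at hn4
    refine tendsto_of_tendsto_of_tendsto_of_le_of_le tendsto_const_nhds hn4 (fun _ => zero_le)
      fun p => ?_
    have heq : integral L (restrict A hA (((h p.1).toStepComb - w p.1)
        - ((h p.2).toStepComb - w p.2))) = ((h p.1).integral L A - ZA)
          + (ZA - (h p.2).integral L A) + integral L (restrict A hA (w p.2 - w p.1)) := by
      rw [← SimpleIntegrand.integral_restrict_toStepComb _ hA,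
        ← SimpleIntegrand.integral_restrict_toStepComb _ hA]
      simp only [map_sub]
      abel
    rw [heq]
    have ha1 := ((hmeas A hA p.1).aemeasurable (μ := P)).sub hZAm
    have ha2 := hZAm.sub ((hmeas A hA p.2).aemeasurable (μ := P))
    exact (MSTOU.probNorm_add_le (ha1.add ha2)).trans
      (add_le_add_left (MSTOU.probNorm_add_le ha1) _)
  have hae : ∀ᵐ z ∂κ, Tendsto (fun n => toFun ((h n).toStepComb - w n) z) atTop (𝓝 0) := by
    filter_upwards [happ.ae_tendsto] with z hz
    simpa [SimpleIntegrand.toFun_toStepComb] using hz.sub (hw z)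
  have huniq := tendsto_probNorm_of_ae_tendsto_zero hM hae hsub
  have hYn := tendsto_probNorm_sub_of_tendstoInMeasure hlim
  have hYm : AEMeasurable Y P := hlim.aemeasurable fun n => (hmeas _ .univ n).aemeasurable
  have hZmeas : AEMeasurable Z P := (Lp.aestronglyMeasurable Z).aemeasurable
  have hYZ : Y =ᵐ[P] Z := by
    refine ae_eq_of_probNorm_sub_eq_zero hYm hZmeas ?_
    have hs := ((hYn.add huniq).add hZm)
    rw [add_zero, add_zero] at hs
    refine le_antisymm (ge_of_tendsto' hs fun n => ?_) zero_le
    have heq : Y - Z = (Y - (h n).integral L Set.univ) + integral L ((h n).toStepComb - w n)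
        + (integral L (w n) - Z) := by
      rw [map_sub, SimpleIntegrand.integral_toStepComb]
      abel
    have ha := hYm.sub ((hmeas _ .univ n).aemeasurable (μ := P))
    rw [heq, probNorm_sub_comm P ((h n).integral L Set.univ) Y]
    exact (MSTOU.probNorm_add_le (ha.add (measurable_integral hM _).aemeasurable)).trans
      (add_le_add_left (MSTOU.probNorm_add_le ha) _)
  have hL2 : MemLp Y 2 P := (memLp_congr_ae hYZ).2 (Lp.memLp Z)
  refine ⟨w, hL2, hw, hwg, ?_⟩
  have : hL2.toLp Y = Z := by
    rw [← Lp.toLp_coeFn Z (Lp.memLp Z)]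
    exact MemLp.toLp_congr _ _ hYZ
  rwa [this]

lemma integral_mul_eq_inner_toLp {X Y : Ω → ℝ} (hX : MemLp X 2 P) (hY : MemLp Y 2 P) :
    ∫ ω, X ω * Y ω ∂P = inner ℝ (hX.toLp X) (hY.toLp Y) := by
  rw [L2.inner_def]
  refine integral_congr_ae ?_
  filter_upwards [hX.coeFn_toLp, hY.coeFn_toLp] with ω h1 h2
  rw [h1, h2]
  simp [mul_comm]

open StepComb in
/-- The first two moments of stochastic integrals. -/
theorem IsStochIntegral.moments [IsProbabilityMeasure P]
    [SigmaFinite (volume : Measure S)] (hM : IsSecondOrder P L κ μ v) {g g' : S → ℝ} {Y Y' : Ω → ℝ}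
    (hY : IsStochIntegral P L κ g Set.univ Y) (hg : Integrable g κ)
    (hg2 : Integrable (fun z => g z ^ 2) κ)
    (hY' : IsStochIntegral P L κ g' Set.univ Y') (hg' : Integrable g' κ)
    (hg2' : Integrable (fun z => g' z ^ 2) κ) :
    MemLp Y 2 P ∧ ∫ ω, Y ω ∂P = μ * ∫ z, g z ∂κ ∧
      ∫ ω, Y ω * Y' ω ∂P
        = v * ∫ z, g z * g' z ∂κ + μ ^ 2 * ((∫ z, g z ∂κ) * ∫ z, g' z ∂κ) := by
  obtain ⟨w, hL, hw, hwg, ht⟩ := hY.exists_tendsto_toLp hM hg hg2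
  obtain ⟨w', hL', hw', hwg', ht'⟩ := hY'.exists_tendsto_toLp hM hg' hg2'
  have hmean : ∀ {f : S → ℝ} {u : ℕ → StepComb S}, Integrable f κ →
      (∀ z, Tendsto (fun n => toFun (u n) z) atTop (𝓝 (f z))) →
      (∀ n z, |toFun (u n) z| ≤ 2 * |f z|) →
      Tendsto (fun n => ∫ z, toFun (u n) z ∂κ) atTop (𝓝 (∫ z, f z ∂κ)) := fun hf hu hb =>
    tendsto_integral_of_dominated_convergence _
      (fun n => (measurable_toFun _).aestronglyMeasurable) (hf.abs.const_mul 2)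
      (fun n => Eventually.of_forall (hb n)) (Eventually.of_forall hu)
  have hprod : Tendsto (fun n => ∫ z, toFun (w n) z * toFun (w' n) z ∂κ) atTop
      (𝓝 (∫ z, g z * g' z ∂κ)) := by
    refine tendsto_integral_of_dominated_convergence (fun z => 4 * (|g z| ^ 2 + |g' z| ^ 2))
      (fun n => ((measurable_toFun _).mul (measurable_toFun _)).aestronglyMeasurable)
      (by simpa using (hg2.add hg2').const_mul 4)
      (fun n => Eventually.of_forall fun z => ?_)
      (Eventually.of_forall fun z => (hw z).mul (hw' z))
    rw [norm_mul, Real.norm_eq_abs, Real.norm_eq_abs]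
    have := mul_le_mul (hwg n z) (hwg' n z) (abs_nonneg _) (by positivity)
    nlinarith [sq_nonneg (|g z| - |g' z|), sq_nonneg |g z|, sq_nonneg |g' z|]
  refine ⟨hL, ?_, ?_⟩
  · have h1 : MemLp (fun _ : Ω => (1 : ℝ)) 2 P := memLp_const 1
    have h2 := ht.inner (tendsto_const_nhds (x := h1.toLp _)) (𝕜 := ℝ)
    simp only [← integral_mul_eq_inner_toLp, mul_one, mean_integral hM] at h2
    exact tendsto_nhds_unique h2 ((hmean hg hw hwg).const_mul μ)
  · have h2 := ht.inner ht' (𝕜 := ℝ)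
    simp only [← integral_mul_eq_inner_toLp, mul_integral hM] at h2
    exact tendsto_nhds_unique h2 ((hprod.const_mul v).add
      (((hmean hg hw hwg).mul (hmean hg' hw' hwg')).const_mul (μ ^ 2)))

end StochIntegral


/-! ### Integrals of the kernel -/

instance sigmaFinite_volume_Ioi : SigmaFinite (volume : Measure (Set.Ioi (0 : ℝ))) := by
  have h : Measure.map Subtype.val (volume : Measure (Set.Ioi (0 : ℝ)))
      = volume.restrict (Set.Ioi 0) := map_comap_subtype_coe measurableSet_Ioi _
  exact SigmaFinite.of_map _ measurable_subtype_coe.aemeasurable (by rw [h]; infer_instance)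

lemma lintegral_rpow_mul_exp_neg {a r : ℝ} (ha : 0 < a) (hr : 0 < r) :
    ∫⁻ t in Set.Ioi (0 : ℝ), ENNReal.ofReal (t ^ (a - 1) * Real.exp (-(r * t)))
      = ENNReal.ofReal ((1 / r) ^ a * Real.Gamma a) := by
  have h := Real.integral_rpow_mul_exp_neg_mul_Ioi ha hr
  rw [← h, ofReal_integral_eq_lintegral_ofReal]
  · refine Integrable.of_integral_ne_zero ?_
    rw [h]
    have := Real.Gamma_pos_of_pos ha
    positivity
  · filter_upwards [ae_restrict_mem measurableSet_Ioi] with t ht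
    have : (0 : ℝ) < t := ht
    positivity

/-- The substitution s = t - d / (2c) - v moves the origin to the time at which the interval length
vanishes. Later times contribute nothing, since `ENNReal.ofReal` truncates negative lengths, and a
Gamma integral of shape 2 remains. -/
lemma lintegral_time {c d p q r t : ℝ} (hc : 0 < c) (hd : 0 ≤ d) (hp : 0 < p) (hr : 0 < r) :
    ∫⁻ s, (Set.Iic t).indicator (fun s => ENNReal.ofReal (2 * c * (t - s) - d)
        * ENNReal.ofReal (Real.exp (-r * (p * (t - s) + q)))) s
      = ENNReal.ofReal (2 * c / p ^ 2 * (Real.exp (-(r * (p * d / (2 * c) + q))) / r ^ 2)) := by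
  rw [← lintegral_sub_left_eq_self _ (t - d / (2 * c))]
  set Q := p * d / (2 * c) + q with hQ
  have h1 : ∀ v, (Set.Iic t).indicator (fun s => ENNReal.ofReal (2 * c * (t - s) - d)
        * ENNReal.ofReal (Real.exp (-r * (p * (t - s) + q)))) (t - d / (2 * c) - v)
      = (Set.Ioi (0 : ℝ)).indicator (fun v => ENNReal.ofReal (2 * c * Real.exp (-(r * Q)))
        * ENNReal.ofReal (v ^ ((2 : ℝ) - 1) * Real.exp (-((r * p) * v)))) v := by
    intro v
    have e1 : 2 * c * (t - (t - d / (2 * c) - v)) - d = 2 * c * v := by field_simp; ring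
    have e2 : -r * (p * (t - (t - d / (2 * c) - v)) + q) = -(r * Q) + -((r * p) * v) := by
      rw [hQ]; field_simp; ring
    have e3 : 0 ≤ d / (2 * c) := by positivity
    by_cases hv : 0 < v
    · rw [Set.indicator_of_mem (by simp only [Set.mem_Iic]; linarith),
        Set.indicator_of_mem (by simpa using hv), e1, e2, Real.exp_add,
        ← ENNReal.ofReal_mul (by positivity), ← ENNReal.ofReal_mul (by positivity)]
      norm_num
      congr 1
      ring
    · rw [Set.indicator_of_notMem (s := Set.Ioi (0 : ℝ)) (by simpa using hv)]
      simp only [Set.indicator_apply, e1]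
      rw [ENNReal.ofReal_of_nonpos (mul_nonpos_of_nonneg_of_nonpos (by positivity) (not_lt.1 hv)), zero_mul, ite_self]
  rw [lintegral_congr h1, lintegral_indicator measurableSet_Ioi,
    lintegral_const_mul _ (by fun_prop), lintegral_rpow_mul_exp_neg two_pos (by positivity),
    ← ENNReal.ofReal_mul (by positivity)]
  congr 1
  have : Real.Gamma 2 = 1 := by simp
  rw [this, Real.rpow_two]
  field_simp

/-- The factor 1 / r² lowers the Gamma shape from α to α - 2; this is where α > 2 enters. -/
lemma lintegral_rate {α β Q : ℝ} (hα : 2 < α) (hβ : 0 < β) (hQ : 0 ≤ Q) :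
    ∫⁻ r : Set.Ioi (0 : ℝ), gammaPDF α β r
        * ENNReal.ofReal (Real.exp (-((r : ℝ) * Q)) / (r : ℝ) ^ 2)
      = ENNReal.ofReal (β ^ α / ((α - 1) * (α - 2) * (β + Q) ^ (α - 2))) := by
  have hG : 0 < Real.Gamma (α - 2) := Real.Gamma_pos_of_pos (by linarith)
  have hGα : Real.Gamma α = (α - 1) * ((α - 2) * Real.Gamma (α - 2)) := by
    rw [← Real.Gamma_add_one (show α - 2 ≠ 0 by linarith), show α - 2 + 1 = α - 1 by ring,
      ← Real.Gamma_add_one (show α - 1 ≠ 0 by linarith), sub_add_cancel]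
  have h1 : 0 < α - 1 := by linarith
  have h2 : 0 < α - 2 := by linarith
  have h3 : 0 < β + Q := by linarith
  have hcomap := lintegral_subtype_comap (μ := (volume : Measure ℝ))
    (measurableSet_Ioi (a := (0 : ℝ)))
    fun r => gammaPDF α β r * ENNReal.ofReal (Real.exp (-(r * Q)) / r ^ 2)
  refine hcomap.trans ?_
  have hcongr : ∀ r ∈ Set.Ioi (0 : ℝ),
      gammaPDF α β r * ENNReal.ofReal (Real.exp (-(r * Q)) / r ^ 2)
      = ENNReal.ofReal (β ^ α / Real.Gamma α)
        * ENNReal.ofReal (r ^ (α - 2 - 1) * Real.exp (-((β + Q) * r))) := by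
    intro r hr
    have hr' : 0 < r := hr
    have hGα' : 0 < Real.Gamma α := Real.Gamma_pos_of_pos (by linarith)
    rw [gammaPDF_of_nonneg hr'.le, ← ENNReal.ofReal_mul (by positivity),
      ← ENNReal.ofReal_mul (by positivity), show α - 2 - 1 = α - 1 - 2 by ring,
      Real.rpow_sub hr' (α - 1) 2, Real.rpow_two,
      show -((β + Q) * r) = -(β * r) + -(r * Q) by ring, Real.exp_add]
    congr 1
    ring
  rw [setLIntegral_congr_fun measurableSet_Ioi hcongr, lintegral_const_mul _ (by fun_prop),
    lintegral_rpow_mul_exp_neg h2 h3, ← ENNReal.ofReal_mul (by rw [hGα]; positivity), hGα,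
    Real.div_rpow zero_le_one h3.le, Real.one_rpow]
  congr 1
  field_simp

lemma measurableSet_cone (t : ℝ) {A B : ℝ → ℝ} (hA : Measurable A) (hB : Measurable B) :
    MeasurableSet {z : Domain | z.2.1 ≤ t ∧ A z.2.1 ≤ z.1 ∧ z.1 ≤ B z.2.1} := by
  have h1 : Measurable fun z : Domain => z.1 := by fun_prop
  have h2 : Measurable fun z : Domain => z.2.1 := by fun_prop
  exact (measurableSet_le h2 measurable_const).inter
    ((measurableSet_le (hA.comp h2) h1).inter (measurableSet_le h1 (hB.comp h2)))

/-- Integrals of exponentials over a family of intervals of length `2 c (t - s) - d` which widens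
linearly in `t - s`. -/
lemma lintegral_cone {α β c d p q t : ℝ} (hα : 2 < α) (hβ : 0 < β) (hc : 0 < c) (hd : 0 ≤ d)
    (hp : 0 < p) (hq : 0 ≤ q) {A B : ℝ → ℝ} (hA : Measurable A) (hB : Measurable B)
    (hAB : ∀ s, B s - A s = 2 * c * (t - s) - d) :
    ∫⁻ z : Domain, {z : Domain | z.2.1 ≤ t ∧ A z.2.1 ≤ z.1 ∧ z.1 ≤ B z.2.1}.indicator
        (fun z => ENNReal.ofReal (Real.exp (-(z.2.2 : ℝ) * (p * (t - z.2.1) + q)))) z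
        ∂(controlMeasure (gammaPDF α β))
      = ENNReal.ofReal (2 * c / p ^ 2
        * (β ^ α / ((α - 1) * (α - 2) * (β + (p * d / (2 * c) + q)) ^ (α - 2)))) := by
  have hpdf : Measurable (gammaPDF α β) := (measurable_gammaPDFReal α β).ennreal_ofReal
  have hset := measurableSet_cone t hA hB
  set F : Domain → ENNReal := {z : Domain | z.2.1 ≤ t ∧ A z.2.1 ≤ z.1 ∧ z.1 ≤ B z.2.1}.indicator
        (fun z => ENNReal.ofReal (Real.exp (-(z.2.2 : ℝ) * (p * (t - z.2.1) + q)))) with hF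
  have hFm : Measurable F := Measurable.indicator (by fun_prop) hset
  have hspace : ∀ (r : Set.Ioi (0 : ℝ)) (s : ℝ), ∫⁻ ξ, F (ξ, s, r)
      = (Set.Iic t).indicator (fun s => ENNReal.ofReal (2 * c * (t - s) - d)
        * ENNReal.ofReal (Real.exp (-(r : ℝ) * (p * (t - s) + q)))) s := by
    intro r s
    by_cases hs : s ≤ t
    · have : ∀ ξ, F (ξ, s, r) = (Set.Icc (A s) (B s)).indicator
          (fun _ => ENNReal.ofReal (Real.exp (-(r : ℝ) * (p * (t - s) + q)))) ξ := by
        intro ξ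
        simp [hF, Set.indicator_apply, hs]
      rw [lintegral_congr this, lintegral_indicator_const measurableSet_Icc, Real.volume_Icc, hAB,
        Set.indicator_of_mem (by simpa using hs), mul_comm]
    · have : ∀ ξ, F (ξ, s, r) = 0 := by
        intro ξ
        simp [hF, hs]
      rw [lintegral_congr this, lintegral_zero, Set.indicator_of_notMem (by simpa using hs)]
  have hK := lintegral_rate (Q := p * d / (2 * c) + q) hα hβ (by positivity)
  rw [controlMeasure, lintegral_withDensity_eq_lintegral_mul _ (by fun_prop) hFm]
  calc ∫⁻ z : Domain, ((fun z : Domain => gammaPDF α β z.2.2) * F) z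
      = ∫⁻ y : ℝ × Set.Ioi (0 : ℝ), ∫⁻ ξ : ℝ, gammaPDF α β y.2 * F (ξ, y) :=
        lintegral_prod_symm' _ (by fun_prop)
    _ = ∫⁻ y : ℝ × Set.Ioi (0 : ℝ), gammaPDF α β y.2 * ∫⁻ ξ : ℝ, F (ξ, y) :=
        lintegral_congr fun y => lintegral_const_mul _ (by fun_prop)
    _ = ∫⁻ r : Set.Ioi (0 : ℝ), ∫⁻ s : ℝ, gammaPDF α β r * ∫⁻ ξ : ℝ, F (ξ, s, r) :=
        lintegral_prod_symm' _ (by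
          refine Measurable.mul (by fun_prop) ?_
          exact Measurable.lintegral_prod_left' hFm)
    _ = ∫⁻ r : Set.Ioi (0 : ℝ), ENNReal.ofReal (2 * c / p ^ 2) * (gammaPDF α β r
          * ENNReal.ofReal (Real.exp (-((r : ℝ) * (p * d / (2 * c) + q))) / (r : ℝ) ^ 2)) := by
        refine lintegral_congr fun r => ?_
        simp only [hspace r]
        rw [lintegral_const_mul _ (Measurable.indicator (by fun_prop) measurableSet_Iic),
          lintegral_time hc hd hp r.2, ENNReal.ofReal_mul (by positivity)]
        ring
    _ = _ := by
        rw [lintegral_const_mul _ (by fun_prop), hK, ← ENNReal.ofReal_mul (by positivity)]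

/-- One formula serves every moment: (p, q, d) is (1, 0, 0) for the mean, (2, 0, lag) for spatial
products and (2, lag, 0) for temporal ones. -/
lemma integral_cone {α β c d p q t : ℝ} (hα : 2 < α) (hβ : 0 < β) (hc : 0 < c) (hd : 0 ≤ d)
    (hp : 0 < p) (hq : 0 ≤ q) {A B : ℝ → ℝ} (hA : Measurable A) (hB : Measurable B)
    (hAB : ∀ s, B s - A s = 2 * c * (t - s) - d) {F : Domain → ℝ}
    (hF : ∀ z, F z = {z : Domain | z.2.1 ≤ t ∧ A z.2.1 ≤ z.1 ∧ z.1 ≤ B z.2.1}.indicator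
        (fun z => Real.exp (-(z.2.2 : ℝ) * (p * (t - z.2.1) + q))) z) :
    Integrable F (controlMeasure (gammaPDF α β)) ∧
      ∫ z, F z ∂(controlMeasure (gammaPDF α β)) = 2 * c / p ^ 2
        * (β ^ α / ((α - 1) * (α - 2) * (β + (p * d / (2 * c) + q)) ^ (α - 2))) := by
  have h := lintegral_cone (p := p) hα hβ hc hd hp hq hA hB hAB
  have hset := measurableSet_cone t hA hB
  have hFm : Measurable F := by
    rw [funext hF]; exact Measurable.indicator (by fun_prop) hset
  have hF0 : ∀ z, 0 ≤ F z := fun z => by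
    rw [hF]; exact Set.indicator_nonneg (fun _ _ => (Real.exp_pos _).le) z
  have hFe : ∀ z, ENNReal.ofReal (F z) = {z : Domain | z.2.1 ≤ t ∧ A z.2.1 ≤ z.1 ∧
      z.1 ≤ B z.2.1}.indicator
        (fun z => ENNReal.ofReal (Real.exp (-(z.2.2 : ℝ) * (p * (t - z.2.1) + q)))) z := fun z => by
    rw [hF]
    by_cases hz : z ∈ {z : Domain | z.2.1 ≤ t ∧ A z.2.1 ≤ z.1 ∧ z.1 ≤ B z.2.1}
    · rw [Set.indicator_of_mem hz, Set.indicator_of_mem hz]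
    · rw [Set.indicator_of_notMem hz, Set.indicator_of_notMem hz, ENNReal.ofReal_zero]
  rw [← lintegral_congr hFe] at h
  constructor
  · refine (lintegral_ofReal_ne_top_iff_integrable hFm.aestronglyMeasurable
      (Eventually.of_forall hF0)).1 ?_
    rw [h]; exact ENNReal.ofReal_ne_top
  · rw [integral_eq_lintegral_of_nonneg_ae (Eventually.of_forall hF0) hFm.aestronglyMeasurable, h]
    have h1 : 0 < α - 1 := by linarith
    have h2 : 0 < α - 2 := by linarith
    rw [ENNReal.toReal_ofReal (by positivity)]


/-! ### Identifiability of the parameters from the moments -/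

/-- Strict convexity of the power at 1 + u, the midpoint of 1 and 1 + 2u. -/
lemma two_mul_rpow_sub_one_lt {q u : ℝ} (hq : 1 < q) (hu : 0 < u) :
    2 * (1 + u) ^ q - 1 < (1 + 2 * u) ^ q := by
  have h1 : (1 : ℝ) ∈ Set.Ici (0 : ℝ) := by simp
  have h2 : 1 + 2 * u ∈ Set.Ici (0 : ℝ) := by rw [Set.mem_Ici]; linarith
  have h := (strictConvexOn_rpow hq).2 h1 h2 (by linarith) (half_pos one_pos) (half_pos one_pos)
    (add_halves 1)
  simp only [smul_eq_mul, Real.one_rpow] at h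
  rw [show (1 / 2 : ℝ) * 1 + 1 / 2 * (1 + 2 * u) = 1 + u by ring] at h
  linarith

/-- With r = p / q the hypotheses read 1 + w = (1 + u)^r and 1 + 2w = (1 + 2u)^r. If u < w then r >
1, and strict convexity makes (1 + 2u)^r exceed 2(1 + u)^r - 1 = 1 + 2w. -/
lemma not_lt_of_rpow_eq {p q u w : ℝ} (hq : 0 < q) (hu : 0 < u)
    (h1 : (1 + u) ^ p = (1 + w) ^ q) (h2 : (1 + 2 * u) ^ p = (1 + 2 * w) ^ q) : ¬ u < w := by
  intro huw
  have key : ∀ y : ℝ, 0 < y → ∀ x : ℝ, 0 < x → x ^ p = y ^ q → y = x ^ (p / q) := by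
    intro y hy x hx h
    rw [div_eq_mul_inv, Real.rpow_mul hx.le, h, ← Real.rpow_mul hy.le, mul_inv_cancel₀ hq.ne',
      Real.rpow_one]
  have k1 := key (1 + w) (by linarith) (1 + u) (by linarith) h1
  have k2 := key (1 + 2 * w) (by linarith) (1 + 2 * u) (by linarith) h2
  have hr : 1 < p / q := by
    by_contra h
    have : (1 + u) ^ (p / q) ≤ (1 + u) ^ (1 : ℝ) :=
      Real.rpow_le_rpow_of_exponent_le (by linarith) (not_lt.1 h)
    rw [Real.rpow_one] at this
    linarith
  have := two_mul_rpow_sub_one_lt hr hu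
  rw [← k1, ← k2] at this
  linarith

lemma eq_and_eq_of_rpow_eq {p q u w : ℝ} (hp : 0 < p) (hq : 0 < q) (hu : 0 < u) (hw : 0 < w)
    (h1 : (1 + u) ^ p = (1 + w) ^ q) (h2 : (1 + 2 * u) ^ p = (1 + 2 * w) ^ q) :
    p = q ∧ u = w := by
  have huw : u = w := le_antisymm (not_lt.1 (not_lt_of_rpow_eq hp hw h1.symm h2.symm))
    (not_lt.1 (not_lt_of_rpow_eq hq hu h1 h2))
  subst huw
  refine ⟨?_, rfl⟩
  have := congrArg Real.log h1
  rw [Real.log_rpow (by linarith), Real.log_rpow (by linarith)] at this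
  exact mul_right_cancel₀ (Real.log_pos (by linarith)).ne' this

/-- The variance of the process in the model with parameter `θ`. -/
def modelVar (θ : Params) : ℝ := θ.c * θ.β ^ 2 * θ.var / (2 * (θ.α - 2) * (θ.α - 1))

/-- Separates the variance from the correlation, which depends on α, β and x alone; x is the
temporal lag or the spatial lag divided by c. -/
lemma model_cov_eq {θ : Params} (hθ : θ ∈ paramSpace) {x : ℝ} (hx : 0 ≤ x) :
    θ.c * θ.β ^ θ.α * θ.var / (2 * (θ.β + x) ^ (θ.α - 2) * (θ.α - 2) * (θ.α - 1))
      = modelVar θ * ((1 + x / θ.β) ^ (θ.α - 2))⁻¹ := by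
  obtain ⟨hα, hβ, hc, -⟩ := hθ
  have h1 : 0 < θ.α - 2 := by linarith
  have h2 : 0 < θ.α - 1 := by linarith
  have h3 : θ.β + x = θ.β * (1 + x / θ.β) := by field_simp
  have h4 : θ.β ^ θ.α = θ.β ^ 2 * θ.β ^ (θ.α - 2) := by
    rw [← Real.rpow_two, ← Real.rpow_add hβ]; ring_nf
  have h5 : 0 < 1 + x / θ.β := by positivity
  rw [h3, Real.mul_rpow hβ.le h5.le, h4, modelVar]
  have h6 : 0 < θ.β ^ (θ.α - 2) := by positivity
  have h7 : 0 < (1 + x / θ.β) ^ (θ.α - 2) := by positivity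
  field_simp

/-- The second-order structure of the model determines its parameters. -/
theorem params_eq_of_moments_eq {θ θ₀ : Params} (hθ : θ ∈ paramSpace) (hθ₀ : θ₀ ∈ paramSpace)
    {Δ : ℝ} (hΔ : 0 < Δ) (hmean : modelMean θ = modelMean θ₀)
    (hvar : modelVar θ = modelVar θ₀)
    (hspace : ((1 + Δ / θ.c / θ.β) ^ (θ.α - 2))⁻¹ = ((1 + Δ / θ₀.c / θ₀.β) ^ (θ₀.α - 2))⁻¹)
    (htime : ((1 + Δ / θ.β) ^ (θ.α - 2))⁻¹ = ((1 + Δ / θ₀.β) ^ (θ₀.α - 2))⁻¹)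
    (htime2 : ((1 + 2 * Δ / θ.β) ^ (θ.α - 2))⁻¹ = ((1 + 2 * Δ / θ₀.β) ^ (θ₀.α - 2))⁻¹) :
    θ = θ₀ := by
  obtain ⟨hα, hβ, hc, -⟩ := hθ
  obtain ⟨hα₀, hβ₀, hc₀, -⟩ := hθ₀
  rw [mul_div_assoc, mul_div_assoc] at htime2
  obtain ⟨eα, eβ⟩ := eq_and_eq_of_rpow_eq (by linarith) (by linarith) (div_pos hΔ hβ)
    (div_pos hΔ hβ₀) (inv_injective htime) (inv_injective htime2)
  have eα : θ.α = θ₀.α := by linarith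
  have eβ : θ.β = θ₀.β := by
    rw [div_eq_div_iff hβ.ne' hβ₀.ne'] at eβ
    exact (mul_left_cancel₀ hΔ.ne' eβ).symm
  have ec : θ.c = θ₀.c := by
    rw [eα, eβ] at hspace
    have h := Real.rpow_left_injOn (x := θ₀.α - 2) (by linarith)
      (show 0 ≤ 1 + Δ / θ.c / θ₀.β by positivity) (show 0 ≤ 1 + Δ / θ₀.c / θ₀.β by positivity)
      (inv_injective hspace)
    have h' : Δ / θ.c = Δ / θ₀.c := by
      have := add_left_cancel h
      rw [div_eq_div_iff hβ₀.ne' hβ₀.ne'] at this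
      exact mul_right_cancel₀ hβ₀.ne' this
    rw [div_eq_div_iff hc.ne' hc₀.ne'] at h'
    exact (mul_left_cancel₀ hΔ.ne' h').symm
  have h1 : 0 < θ₀.α - 2 := by linarith
  have h2 : 0 < θ₀.α - 1 := by linarith
  refine Params.ext eα eβ ec ?_ ?_
  · rw [modelMean, modelMean, eα, eβ, ec, div_left_inj' (by positivity)] at hmean
    exact mul_left_cancel₀ (by positivity) hmean
  · rw [modelVar, modelVar, eα, eβ, ec, div_left_inj' (by positivity)] at hvar
    exact mul_left_cancel₀ (by positivity) hvar


/-! ### Second-order structure of the process -/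

lemma kernel_ambitSet (c x t : ℝ) (z : Domain) :
    kernel (ambitSet (fun w => c * w) x t) t z
      = {z : Domain | z.2.1 ≤ t ∧ x - c * (t - z.2.1) ≤ z.1 ∧
          z.1 ≤ x + c * (t - z.2.1)}.indicator
        (fun z => Real.exp (-(z.2.2 : ℝ) * (t - z.2.1))) z := by
  rw [kernel, Set.indicator_apply]
  congr 1
  simp only [ambitSet, Set.mem_ofPred_eq, eq_iff_iff, abs_le]
  refine and_congr_right fun h => ?_
  rw [abs_of_nonneg (sub_nonneg.2 h)]
  constructor <;> rintro ⟨h1, h2⟩ <;> constructor <;> linarith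

lemma integral_sub_const_sub_const {Ω : Type*} [MeasurableSpace Ω] {P : Measure Ω}
    [IsProbabilityMeasure P] {X : Ω → ℝ} (hX : Integrable X P) (a b : ℝ) :
    ∫ ω, (X ω - a - b) ∂P = ∫ ω, X ω ∂P - a - b := by
  have h : Integrable (fun ω => X ω - a) P := hX.sub (integrable_const a)
  rw [integral_sub h (integrable_const b), integral_sub hX (integrable_const a)]
  simp

section Moments

variable {α β c : ℝ} (hα : 2 < α) (hβ : 0 < β) (hc : 0 < c)

include hα hβ hc

lemma integral_kernel (x t : ℝ) :
    Integrable (kernel (ambitSet (fun w => c * w) x t) t) (controlMeasure (gammaPDF α β)) ∧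
      ∫ z, kernel (ambitSet (fun w => c * w) x t) t z ∂(controlMeasure (gammaPDF α β))
        = 2 * c * β ^ 2 / ((α - 2) * (α - 1)) := by
  obtain ⟨h1, h2⟩ := integral_cone (p := 1) (q := 0) (d := 0) (t := t) hα hβ hc le_rfl one_pos
    le_rfl (A := fun s => x - c * (t - s)) (B := fun s => x + c * (t - s)) (by fun_prop)
    (by fun_prop) (fun s => by ring) (F := kernel (ambitSet (fun w => c * w) x t) t)
    (fun z => by simp only [kernel_ambitSet, one_mul, add_zero])
  refine ⟨h1, h2.trans ?_⟩
  have e1 : 0 < α - 1 := by linarith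
  have e2 : 0 < α - 2 := by linarith
  have e3 : β ^ α = β ^ 2 * β ^ (α - 2) := by
    rw [← Real.rpow_two, ← Real.rpow_add hβ]; ring_nf
  have e4 : 0 < β ^ (α - 2) := by positivity
  simp only [mul_zero, zero_div, add_zero]
  rw [e3]
  field_simp

/-- The two cones meet between the left edge of the one at x + d and the right edge of the one at x,
an interval of length 2c(t - s) - d. -/
lemma integral_kernel_mul_space (x t : ℝ) {d : ℝ} (hd : 0 ≤ d) :
    Integrable (fun z => kernel (ambitSet (fun w => c * w) x t) t z
        * kernel (ambitSet (fun w => c * w) (x + d) t) t z) (controlMeasure (gammaPDF α β)) ∧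
      ∫ z, kernel (ambitSet (fun w => c * w) x t) t z
        * kernel (ambitSet (fun w => c * w) (x + d) t) t z ∂(controlMeasure (gammaPDF α β))
        = c * β ^ α / (2 * (β + d / c) ^ (α - 2) * (α - 2) * (α - 1)) := by
  obtain ⟨h1, h2⟩ := integral_cone (p := 2) (q := 0) (d := d) (t := t) hα hβ hc hd two_pos
    le_rfl (A := fun s => x + d - c * (t - s)) (B := fun s => x + c * (t - s)) (by fun_prop)
    (by fun_prop) (fun s => by ring) (F := fun z => kernel (ambitSet (fun w => c * w) x t) t z
        * kernel (ambitSet (fun w => c * w) (x + d) t) t z)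
    (fun z => by
      simp only [kernel_ambitSet, Set.indicator_apply, Set.mem_ofPred_eq]
      rw [ite_zero_mul_ite_zero, ← Real.exp_add]
      refine if_congr ?_ (by ring_nf) rfl
      constructor
      · rintro ⟨⟨h1, h2, h3⟩, h4, h5, h6⟩
        exact ⟨h1, h5, h3⟩
      · rintro ⟨h1, h2, h3⟩
        exact ⟨⟨h1, by linarith, h3⟩, h1, h2, by linarith⟩)
  refine ⟨h1, h2.trans ?_⟩
  have e1 : 0 < α - 1 := by linarith
  have e2 : 0 < α - 2 := by linarith
  rw [show 2 * d / (2 * c) + 0 = d / c by field_simp; ring]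
  have e4 : 0 < (β + d / c) ^ (α - 2) := by positivity
  field_simp

/-- The earlier cone lies inside the later one, so only the exponent changes: the decay factors
combine to 2(t - s) + d. -/
lemma integral_kernel_mul_time (x t : ℝ) {d : ℝ} (hd : 0 ≤ d) :
    Integrable (fun z => kernel (ambitSet (fun w => c * w) x t) t z
        * kernel (ambitSet (fun w => c * w) x (t + d)) (t + d) z)
        (controlMeasure (gammaPDF α β)) ∧
      ∫ z, kernel (ambitSet (fun w => c * w) x t) t z
        * kernel (ambitSet (fun w => c * w) x (t + d)) (t + d) z ∂(controlMeasure (gammaPDF α β))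
        = c * β ^ α / (2 * (β + d) ^ (α - 2) * (α - 2) * (α - 1)) := by
  obtain ⟨h1, h2⟩ := integral_cone (p := 2) (q := d) (d := 0) (t := t) hα hβ hc le_rfl two_pos
    hd (A := fun s => x - c * (t - s)) (B := fun s => x + c * (t - s)) (by fun_prop)
    (by fun_prop) (fun s => by ring) (F := fun z => kernel (ambitSet (fun w => c * w) x t) t z
        * kernel (ambitSet (fun w => c * w) x (t + d)) (t + d) z)
    (fun z => by
      have hcd : 0 ≤ c * d := by positivity
      simp only [kernel_ambitSet, Set.indicator_apply, Set.mem_ofPred_eq]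
      rw [ite_zero_mul_ite_zero, ← Real.exp_add]
      refine if_congr ?_ (by ring_nf) rfl
      constructor
      · rintro ⟨h1, -⟩
        exact h1
      · rintro ⟨h1, h2, h3⟩
        exact ⟨⟨h1, h2, h3⟩, by linarith, by linarith, by linarith⟩)
  refine ⟨h1, h2.trans ?_⟩
  have e1 : 0 < α - 1 := by linarith
  have e2 : 0 < α - 2 := by linarith
  rw [show 2 * 0 / (2 * c) + d = d by simp]
  have e4 : 0 < (β + d) ^ (α - 2) := by positivity
  field_simp

variable {Ω : Type*} [MeasurableSpace Ω] {P : Measure Ω} [IsProbabilityMeasure P]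
  {L : Set Domain → Ω → ℝ} {μ v : ℝ} {Y : ℝ → ℝ → Ω → ℝ}

/-- Mean and autocovariances of the process. -/
theorem IsMSTOU.moments (hM : IsSecondOrder P L (controlMeasure (gammaPDF α β)) μ v)
    (hY : IsMSTOU P L (controlMeasure (gammaPDF α β)) (ambitSet fun w => c * w) Y) (x t : ℝ) :
    MemLp (Y x t) 2 P ∧ ∫ ω, Y x t ω ∂P = modelMean ⟨α, β, c, μ, v⟩ ∧
      (∀ d, 0 ≤ d → ∫ ω, Y x t ω * Y (x + d) t ω ∂P
        = c * β ^ α * v / (2 * (β + d / c) ^ (α - 2) * (α - 2) * (α - 1))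
          + modelMean ⟨α, β, c, μ, v⟩ ^ 2) ∧
      ∀ d, 0 ≤ d → ∫ ω, Y x t ω * Y x (t + d) ω ∂P
        = c * β ^ α * v / (2 * (β + d) ^ (α - 2) * (α - 2) * (α - 1))
          + modelMean ⟨α, β, c, μ, v⟩ ^ 2 := by
  have hint : ∀ x t, _ := fun x t => integral_kernel hα hβ hc x t
  have hsq : ∀ x t, Integrable (fun z => kernel (ambitSet (fun w => c * w) x t) t z ^ 2)
      (controlMeasure (gammaPDF α β)) := fun x t => by
    simpa [sq] using (integral_kernel_mul_time hα hβ hc x t le_rfl).1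
  have hmom : ∀ x' t', _ := fun x' t' => (hY x t).moments hM (hint x t).1 (hsq x t) (hY x' t')
    (hint x' t').1 (hsq x' t')
  have hmean : modelMean ⟨α, β, c, μ, v⟩ = μ * (2 * c * β ^ 2 / ((α - 2) * (α - 1))) := by
    simp only [modelMean]; ring
  refine ⟨(hmom x t).1, ?_, fun d hd => ?_, fun d hd => ?_⟩
  · rw [(hmom x t).2.1, (hint x t).2, hmean]
  · rw [(hmom (x + d) t).2.2, (hint _ _).2, (hint _ _).2,
      (integral_kernel_mul_space hα hβ hc x t hd).2, hmean]
    ring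
  · rw [(hmom x (t + d)).2.2, (hint _ _).2, (hint _ _).2,
      (integral_kernel_mul_time hα hβ hc x t hd).2, hmean]
    ring

end Moments

end MSTOU

end

theorem mainTheorem8
    {Ω Ω' : Type*} [MeasurableSpace Ω] [MeasurableSpace Ω']
    (P : Measure Ω) [IsProbabilityMeasure P] (P' : Measure Ω') [IsProbabilityMeasure P']
    (α β c : ℝ) (hα : 2 < α) (hβ : 0 < β) (hc : 0 < c)
    (a b : ℝ) (ν : Measure ℝ)
    (L : Set MSTOU.Domain → Ω → ℝ) (hL : MSTOU.IsLevyBasis P L)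
    (hCQ : MSTOU.HasCharQuadruplet P L a b ν (MSTOU.controlMeasure (gammaPDF α β)))
    (hL2 : MSTOU.HasFiniteSecondMoments P L)
    (L' : Ω' → ℝ) (hL' : MSTOU.IsLevySeed P' L' a b ν) (hvar : 0 < Var[L'; P'])
    (Y : ℝ → ℝ → Ω → ℝ)
    (hY : MSTOU.IsMSTOU P L (MSTOU.controlMeasure (gammaPDF α β))
      (MSTOU.ambitSet (fun w => c * w)) Y)
    (m : ℕ) (hm : 2 ≤ m) (Δ : ℝ) (hΔ : 0 < Δ)
    (G : Set (ℝ × ℝ)) (hG : G.Nonempty)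
    (θ : MSTOU.Params) (hθ : θ ∈ MSTOU.paramSpace) :
    (∀ (x t : ℝ) (k : MSTOU.MomentIndex m),
      Integrable (fun ω => MSTOU.momentFn Δ (MSTOU.obs Y m Δ x t ω) θ k) P) ∧
    ((∀ p ∈ G, ∀ k : MSTOU.MomentIndex m,
        ∫ ω, MSTOU.momentFn Δ (MSTOU.obs Y m Δ p.1 p.2 ω) θ k ∂P = 0) ↔
      θ = ⟨α, β, c, ∫ ω, L' ω ∂P', Var[L'; P']⟩) := by
  have hM := hL.isSecondOrder hCQ hL2 hL' hvar
  have hmom := hY.moments hα hβ hc hM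
  have hL2Y : ∀ x t, MemLp (Y x t) 2 P := fun x t => (hmom x t).1
  have hiY : ∀ x t, Integrable (Y x t) P := fun x t => (hL2Y x t).integrable one_le_two
  have hiYY : ∀ x t x' t', Integrable (fun ω => Y x t ω * Y x' t' ω) P := fun x t x' t' =>
    (hL2Y x t).integrable_mul (hL2Y x' t')
  have hiY2 : ∀ x t, Integrable (fun ω => Y x t ω ^ 2) P := fun x t => (hL2Y x t).integrable_sq
  have hlag : ∀ h : Fin m, 0 ≤ ((h : ℝ) + 1) * Δ := fun h => by positivity
  set θ₀ : MSTOU.Params := ⟨α, β, c, ∫ ω, L' ω ∂P', Var[L'; P']⟩ with hθ₀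
  have hθ₀m : θ₀ ∈ MSTOU.paramSpace := ⟨hα, hβ, hc, hvar.le⟩
  have hY2 : ∀ x t, ∫ ω, Y x t ω ^ 2 ∂P
      = MSTOU.modelVar θ₀ + MSTOU.modelMean θ₀ ^ 2 := fun x t => by
    have h := (hmom x t).2.2.2 0 le_rfl
    have h' := MSTOU.model_cov_eq hθ₀m le_rfl
    simp only [add_zero, zero_div, Real.one_rpow, inv_one, mul_one] at h h'
    simp only [sq (Y x t _), h]
    exact congrArg (· + _) h'
  have hsp : ∀ x t (h : Fin m), ∫ ω, Y x t ω * Y (x + ((h : ℝ) + 1) * Δ) t ω ∂P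
      = MSTOU.modelVar θ₀ * ((1 + ((h : ℝ) + 1) * Δ / c / β) ^ (α - 2))⁻¹
        + MSTOU.modelMean θ₀ ^ 2 := fun x t h => by
    rw [(hmom x t).2.2.1 _ (hlag h)]
    exact congrArg (· + _) (MSTOU.model_cov_eq hθ₀m (div_nonneg (hlag h) hc.le))
  have hti : ∀ x t (h : Fin m), ∫ ω, Y x t ω * Y x (t + ((h : ℝ) + 1) * Δ) ω ∂P
      = MSTOU.modelVar θ₀ * ((1 + ((h : ℝ) + 1) * Δ / β) ^ (α - 2))⁻¹
        + MSTOU.modelMean θ₀ ^ 2 := fun x t h => by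
    rw [(hmom x t).2.2.2 _ (hlag h)]
    exact congrArg (· + _) (MSTOU.model_cov_eq hθ₀m (hlag h))
  -- A zero variance would erase α, β and c from the covariances; positivity lets the correlations
  -- be compared.
  have hv₀ : 0 < MSTOU.modelVar θ₀ := by
    have h1 : 0 < α - 2 := by linarith
    have h2 : 0 < α - 1 := by linarith
    exact div_pos (by positivity) (by positivity)
  have hθc : 0 < θ.c := hθ.2.2.1
  have e1 : ∀ x t, ∫ ω, MSTOU.momentFn Δ (MSTOU.obs Y m Δ x t ω) θ .mean ∂P
      = MSTOU.modelMean θ₀ - MSTOU.modelMean θ := fun x t => by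
    simp only [MSTOU.momentFn, MSTOU.obs]
    rw [integral_sub (hiY x t) (integrable_const _), (hmom x t).2.1]
    simp
  have e2 : ∀ x t, ∫ ω, MSTOU.momentFn Δ (MSTOU.obs Y m Δ x t ω) θ .variance ∂P
      = MSTOU.modelVar θ₀ + MSTOU.modelMean θ₀ ^ 2 - MSTOU.modelVar θ
        - MSTOU.modelMean θ ^ 2 := fun x t => by
    simp only [MSTOU.momentFn, MSTOU.obs]
    rw [MSTOU.integral_sub_const_sub_const (hiY2 x t), hY2, ← MSTOU.modelVar]
  have e3 : ∀ x t h, ∫ ω, MSTOU.momentFn Δ (MSTOU.obs Y m Δ x t ω) θ (.space h) ∂P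
      = MSTOU.modelVar θ₀ * ((1 + ((h : ℝ) + 1) * Δ / c / β) ^ (α - 2))⁻¹
        + MSTOU.modelMean θ₀ ^ 2
        - MSTOU.modelVar θ * ((1 + ((h : ℝ) + 1) * Δ / θ.c / θ.β) ^ (θ.α - 2))⁻¹
        - MSTOU.modelMean θ ^ 2 := fun x t h => by
    simp only [MSTOU.momentFn, MSTOU.obs]
    rw [MSTOU.integral_sub_const_sub_const (hiYY _ _ _ _), hsp,
      MSTOU.model_cov_eq hθ (div_nonneg (hlag h) hθc.le)]
  have e4 : ∀ x t h, ∫ ω, MSTOU.momentFn Δ (MSTOU.obs Y m Δ x t ω) θ (.time h) ∂P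
      = MSTOU.modelVar θ₀ * ((1 + ((h : ℝ) + 1) * Δ / β) ^ (α - 2))⁻¹
        + MSTOU.modelMean θ₀ ^ 2
        - MSTOU.modelVar θ * ((1 + ((h : ℝ) + 1) * Δ / θ.β) ^ (θ.α - 2))⁻¹
        - MSTOU.modelMean θ ^ 2 := fun x t h => by
    simp only [MSTOU.momentFn, MSTOU.obs]
    rw [MSTOU.integral_sub_const_sub_const (hiYY _ _ _ _), hti,
      MSTOU.model_cov_eq hθ (hlag h)]
  refine ⟨fun x t k => ?_, fun H => ?_, fun H p _ k => ?_⟩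
  · cases k with
    | mean => exact (hiY x t).sub (integrable_const _)
    | variance => exact ((hiY2 x t).sub (integrable_const _)).sub (integrable_const _)
    | space h => exact ((hiYY _ _ _ _).sub (integrable_const _)).sub (integrable_const _)
    | time h => exact ((hiYY _ _ _ _).sub (integrable_const _)).sub (integrable_const _)
  -- The expectations do not depend on the location, so a single point carries all the information.
  · obtain ⟨p, hp⟩ := hG
    have hmean : MSTOU.modelMean θ = MSTOU.modelMean θ₀ := by
      have := H p hp .mean
      rw [e1] at this
      linarith
    have hvar' : MSTOU.modelVar θ = MSTOU.modelVar θ₀ := by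
      have := H p hp .variance
      rw [e2, hmean] at this
      linarith
    have hcancel : ∀ A B M : ℝ, MSTOU.modelVar θ₀ * A + M - MSTOU.modelVar θ₀ * B - M = 0 →
        B = A := fun A B M h => mul_left_cancel₀ hv₀.ne' (by linarith)
    have hs : ∀ h : Fin m, _ := fun h => hcancel _ _ _ (by
      simpa only [e3, hmean, hvar'] using H p hp (.space h))
    have ht : ∀ h : Fin m, _ := fun h => hcancel _ _ _ (by
      simpa only [e4, hmean, hvar'] using H p hp (.time h))
    -- Indices are shifted by one: 0 and 1 stand for lags Δ and 2Δ. The second temporal lag is where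
    -- m ≥ 2 is needed.
    have hs0 := hs ⟨0, by omega⟩
    have ht0 := ht ⟨0, by omega⟩
    have ht1 := ht ⟨1, by omega⟩
    simp only [Nat.cast_zero, Nat.cast_one, zero_add, one_mul, one_add_one_eq_two] at hs0 ht0 ht1
    exact MSTOU.params_eq_of_moments_eq hθ hθ₀m hΔ hmean hvar' hs0 ht0 ht1
  · cases k with
    | mean => rw [e1, H, sub_self]
    | variance => rw [e2, H]; ring
    | space h => rw [e3, H]; simp only [hθ₀]; ring
    | time h => rw [e4, H]; simp only [hθ₀]; ring
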